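/- Let $G=(V,E)$ be a finite simple undirected graph. For $D\subseteq V$, a vertex $v\in D$ is protected in $D$ if $|N[v]\cap D|\ge |N(v)\setminus D|$. A defensive alliance is a non-empty set $D\subseteq V$ all of whose vertices are protected in $D$; it is connected if the induced subgraph $G[D]$ is connected. A connected locally minimal defensive alliance is a connected defensive alliance $D$ such that for every $v\in D$ the set $D\setminus\{v\}$ is not a connected defensive alliance. The problem Connected Locally Minimal Defensive Alliance asks, given $G$ and a number $k\in\mathbb{N}$, whether $G$ has a connected locally minimal defensive alliance $D$ with $|D|\ge k$. Theorem 4.4. Connected Locally Minimal Defensive Alliance is fixed-parameter tractable when parameterized by the solution size $k$ and the maximum degree $\Delta(G)$. That is, there are a computable function $f:\mathbb{N}\times\mathbb{N}\to\mathbb{N}$, a constant $c$ and a single algorithm (a program of a unit-cost random access machine with addition and truncated subtraction, given the adjacency matrix of $G$ and the number $k$) that decides every instance $(G,k)$ in at most $f(k,\Delta(G))\cdot |(G,k)|^{c}$ steps, where $|(G,k)|=|V|^2+\ell(k)+1$ and $\ell(k)$ is the number of binary digits of $k$ (with $\ell(0)=0$). -/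

import Mathlib

/-! ### Alliances -/

section Alliances

variable {V : Type*} [Fintype V] [DecidableEq V] (G : SimpleGraph V) [DecidableRel G.Adj]

/-- `D` is a defensive alliance: it is non-empty, and every `v ∈ D` is protected, that is,
`|N[v] ∩ D| ≥ |N(v) \ D|`. -/
def IsDefensiveAlliance (D : Finset V) : Prop :=
  D.Nonempty ∧
    ∀ v ∈ D, (G.neighborFinset v \ D).card ≤ (insert v (G.neighborFinset v) ∩ D).card

/-- A defensive alliance whose induced subgraph is connected. -/
def IsConnectedDefensiveAlliance (D : Finset V) : Prop :=
  IsDefensiveAlliance G D ∧ (G.induce (D : Set V)).Connected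

/-- A connected defensive alliance `D` such that `D \ {v}` is not a connected defensive alliance
for any `v ∈ D`. -/
def IsConnectedLocallyMinimalDefensiveAlliance (D : Finset V) : Prop :=
  IsConnectedDefensiveAlliance G D ∧ ∀ v ∈ D, ¬ IsConnectedDefensiveAlliance G (D.erase v)

end Alliances

/-! ### Random access machines

Programs over natural-number registers and finitely many random access arrays. The arithmetic
instructions are addition and truncated subtraction; every instruction and every test of a branch
or of a loop costs one step. (There is no multiplication, so this unit-cost measure is polynomially
related to the running time of Turing machines.) -/

/-- Programs. The arguments `d`, `x`, `y` are indices of registers, `A` is the index of an array. -/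
inductive RamProgram : Type
  /-- `reg d := a` -/
  | const (d a : ℕ)
  /-- `reg d := reg x + reg y` -/
  | add (d x y : ℕ)
  /-- `reg d := reg x - reg y` (truncated at `0`) -/
  | sub (d x y : ℕ)
  /-- `reg d := A[reg x]` -/
  | load (d A x : ℕ)
  /-- `A[reg x] := reg y` -/
  | store (A x y : ℕ)
  /-- first `p`, then `q` -/
  | seq (p q : RamProgram)
  /-- if `reg x ≠ 0` then `p` else `q` -/
  | branch (x : ℕ) (p q : RamProgram)
  /-- while `reg x ≠ 0` do `p` -/
  | loop (x : ℕ) (p : RamProgram)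

/-- Memory contents: `reg x` is the content of register `x`, and `arr A m` is the entry `A[m]`. -/
@[ext]
structure RamState : Type where
  reg : ℕ → ℕ
  arr : ℕ → ℕ → ℕ

/-- The state after register `d` received the value `a`. -/
def RamState.setReg (s : RamState) (d a : ℕ) : RamState :=
  ⟨Function.update s.reg d a, s.arr⟩

/-- The state after the entry `A[m]` received the value `a`. -/
def RamState.setArr (s : RamState) (A m a : ℕ) : RamState :=
  ⟨s.reg, Function.update s.arr A (Function.update (s.arr A) m a)⟩

/-- `RamExec p s t s'`: started in state `s`, the program `p` halts after exactly `t` steps, in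
state `s'`. -/
inductive RamExec : RamProgram → RamState → ℕ → RamState → Prop
  | const (d a : ℕ) (s : RamState) : RamExec (.const d a) s 1 (s.setReg d a)
  | add (d x y : ℕ) (s : RamState) :
      RamExec (.add d x y) s 1 (s.setReg d (s.reg x + s.reg y))
  | sub (d x y : ℕ) (s : RamState) :
      RamExec (.sub d x y) s 1 (s.setReg d (s.reg x - s.reg y))
  | load (d A x : ℕ) (s : RamState) :
      RamExec (.load d A x) s 1 (s.setReg d (s.arr A (s.reg x)))
  | store (A x y : ℕ) (s : RamState) :
      RamExec (.store A x y) s 1 (s.setArr A (s.reg x) (s.reg y))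
  | seq {p q : RamProgram} {s s' s'' : RamState} {t t' : ℕ} :
      RamExec p s t s' → RamExec q s' t' s'' → RamExec (.seq p q) s (t + t') s''
  | branch_true {x : ℕ} {p q : RamProgram} {s s' : RamState} {t : ℕ} :
      s.reg x ≠ 0 → RamExec p s t s' → RamExec (.branch x p q) s (1 + t) s'
  | branch_false {x : ℕ} {p q : RamProgram} {s s' : RamState} {t : ℕ} :
      s.reg x = 0 → RamExec q s t s' → RamExec (.branch x p q) s (1 + t) s'
  | loop_done {x : ℕ} {p : RamProgram} {s : RamState} :
      s.reg x = 0 → RamExec (.loop x p) s 1 s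
  | loop_step {x : ℕ} {p : RamProgram} {s s' s'' : RamState} {t t' : ℕ} :
      s.reg x ≠ 0 → RamExec p s t s' → RamExec (.loop x p) s' t' s'' →
        RamExec (.loop x p) s (1 + t + t') s''

/-! ### Parameterized graph problems -/

open Classical in
/-- The initial state for the instance `(G, k)`: register `0` holds the number `n` of vertices,
register `1` holds `k`, array `0` holds the adjacency matrix of `G` row by row, and everything else
is `0`. -/
noncomputable def ramInput {n : ℕ} (G : SimpleGraph (Fin n)) (k : ℕ) : RamState where
  reg := fun x => if x = 0 then n else if x = 1 then k else 0
  arr := fun A m =>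
    if A = 0 ∧ ∃ i j : Fin n, G.Adj i j ∧ m = (i : ℕ) * n + (j : ℕ) then 1 else 0

/-- The size of an instance `(G, k)`: the `n ^ 2` bits of the adjacency matrix and the bits of `k`
in binary (plus one, so that it is positive). -/
def instanceSize (n k : ℕ) : ℕ := n ^ 2 + Nat.size k + 1

/-- A decision problem whose instances are pairs `(G, k)` of a finite simple graph `G` and a
number `k`. -/
abbrev GraphProblem : Type := (n : ℕ) → SimpleGraph (Fin n) → ℕ → Prop

open Classical in
/-- The problem `Q`, with the pair of numbers `κ n G k` as parameter of the instance `(G, k)`, is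
fixed-parameter tractable: a single program, which outputs its answer (`1` for yes, `0` for no) in
register `0`, decides every instance in at most `f (parameter) * size ^ c` steps, where `c` is a
constant and `f` is a computable function. -/
def IsFPT (Q : GraphProblem) (κ : (n : ℕ) → SimpleGraph (Fin n) → ℕ → ℕ × ℕ) : Prop :=
  ∃ (p : RamProgram) (f : ℕ × ℕ → ℕ) (c : ℕ), Computable f ∧
    ∀ (n : ℕ) (G : SimpleGraph (Fin n)) (k : ℕ), ∃ (t : ℕ) (s : RamState),
      RamExec p (ramInput G k) t s ∧
      t ≤ f (κ n G k) * instanceSize n k ^ c ∧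
      s.reg 0 = if Q n G k then 1 else 0

open Classical in
/-- Connected Locally Minimal Defensive Alliance: does `G` have a connected locally minimal
defensive alliance `D` with `|D| ≥ k`? -/
def ConnectedLocallyMinimalDefensiveAlliance : GraphProblem := fun _ G k =>
  ∃ D, IsConnectedLocallyMinimalDefensiveAlliance G D ∧ k ≤ D.card

open Classical in
/-- The combined parameter: the solution size `k` and the maximum degree of `G`. -/
noncomputable def solutionSizeAndMaxDegree (n : ℕ) (G : SimpleGraph (Fin n)) (k : ℕ) : ℕ × ℕ :=
  (k, G.maxDegree)

/-! Call a vertex of an alliance `D` tight if it loses its protection as soon as any one of its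
neighbours in `D` is removed. If `D` is locally minimal and `D \ {v}` is still connected, then
removing `v` unprotects some vertex, and this vertex is a tight neighbour of `v`. Combined with the
structure of cut vertices, this yields vertices locked by a local pattern (`IsKept`): next to one of
two adjacent tight vertices, or next to a tight cut vertex that sees a whole component of the rest
of `D`. If a connected defensive alliance `D₀ ⊇ D` has no vertex outside `D` within distance 3 of a
kept vertex, that vertex survives every removal of vertices one by one through connected defensive
alliances (`IsKept.mem_of_shrinksTo`). Every component split off by a cut vertex contains a kept
vertex (`exists_isKept_of_isComponentOf`).

Hence a large locally minimal `D` can be detected without knowing all of it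
(`exists_forbidden_set`). There are two centres and a set `F` in the balls of radius `k + 5` around
them, disjoint from `D`, such that every shrinking of every connected defensive alliance that
contains `D` and avoids `F` keeps at least `k` vertices. Either two kept vertices are far apart, and
a connected set containing both is large; or all of them are near one centre, and then the shrunken
set is large or `D` fits into the ball, which forces `D₀ = D`.

The algorithm guesses both centres and `F`. Protection is monotone in the set, so peeling off bad
vertices gives the largest connected defensive alliance that contains the first centre and avoids
`F`. It is shrunk greedily to a locally minimal one and its vertices are counted. A success is
always correct, and `exists_forbidden_set` guarantees one when a solution exists. A ball has at most
`(Δ + 1) ^ (k + 5)` vertices, so each pair of centres has at most `2 ^ (2 * (Δ + 1) ^ (k + 5))`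
candidates for `F`, each handled in polynomial time. -/

/-! ### Reasoning about programs -/

/-- Does the program contain an assignment to register `x`? -/
def RamProgram.writesReg : RamProgram → ℕ → Bool
  | .const d _, x => d == x
  | .add d _ _, x => d == x
  | .sub d _ _, x => d == x
  | .load d _ _, x => d == x
  | .store _ _ _, _ => false
  | .seq p q, x => p.writesReg x || q.writesReg x
  | .branch _ p q, x => p.writesReg x || q.writesReg x
  | .loop _ p, x => p.writesReg x

/-- Does the program contain an assignment to an entry of array `A`? -/
def RamProgram.writesArr : RamProgram → ℕ → Bool
  | .const _ _, _ => false
  | .add _ _ _, _ => false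
  | .sub _ _ _, _ => false
  | .load _ _ _, _ => false
  | .store B _ _, A => B == A
  | .seq p q, A => p.writesArr A || q.writesArr A
  | .branch _ p q, A => p.writesArr A || q.writesArr A
  | .loop _ p, A => p.writesArr A

/-- The states `s` and `s'` agree on all registers and arrays that `p` does not write. -/
structure SameOff (p : RamProgram) (s s' : RamState) : Prop where
  reg : ∀ x, p.writesReg x = false → s'.reg x = s.reg x
  arr : ∀ A, p.writesArr A = false → s'.arr A = s.arr A

theorem SameOff.refl (p : RamProgram) (s : RamState) : SameOff p s s :=
  ⟨fun _ _ => rfl, fun _ _ => rfl⟩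

theorem SameOff.trans {p : RamProgram} {s s' s'' : RamState} (h : SameOff p s s')
    (h' : SameOff p s' s'') : SameOff p s s'' :=
  ⟨fun x hx => (h'.reg x hx).trans (h.reg x hx), fun A hA => (h'.arr A hA).trans (h.arr A hA)⟩

theorem SameOff.mono {p q : RamProgram} {s s' : RamState} (h : SameOff p s s')
    (hr : ∀ x, q.writesReg x = false → p.writesReg x = false)
    (ha : ∀ A, q.writesArr A = false → p.writesArr A = false) : SameOff q s s' :=
  ⟨fun x hx => h.reg x (hr x hx), fun A hA => h.arr A (ha A hA)⟩

/-- The frame rule. The footprint is computed from the syntax, so for concrete programs its side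
conditions are settled by `rfl`. -/
theorem RamExec.sameOff {p : RamProgram} {s s' : RamState} {t : ℕ} (h : RamExec p s t s') :
    SameOff p s s' := by
  induction h with
  | const d a s | add d x y s | sub d x y s | load d A x s =>
    refine ⟨fun z hz => ?_, fun _ _ => rfl⟩
    have : z ≠ d := by
      rintro rfl
      simp [RamProgram.writesReg] at hz
    simp [RamState.setReg, this]
  | store A x y s =>
    refine ⟨fun _ _ => rfl, fun B hB => ?_⟩
    have : B ≠ A := by
      rintro rfl
      simp [RamProgram.writesArr] at hB
    simp [RamState.setArr, this]
  | seq _ _ ih ih' =>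
    refine (ih.mono ?_ ?_).trans (ih'.mono ?_ ?_) <;>
      simp +contextual [RamProgram.writesReg, RamProgram.writesArr]
  | branch_true _ _ ih | branch_false _ _ ih =>
    refine ih.mono ?_ ?_ <;> simp +contextual [RamProgram.writesReg, RamProgram.writesArr]
  | loop_done _ => exact .refl _ _
  | loop_step _ _ _ ih ih' =>
    refine SameOff.trans (ih.mono ?_ ?_) ih' <;>
      simp +contextual [RamProgram.writesReg, RamProgram.writesArr]

/-- Started in `s`, the program `p` halts after at most `T` steps in a state satisfying `Q`. -/
def Runs (p : RamProgram) (s : RamState) (T : ℕ) (Q : RamState → Prop) : Prop :=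
  ∃ t s', RamExec p s t s' ∧ t ≤ T ∧ Q s'

theorem Runs.mono {p : RamProgram} {s : RamState} {T T' : ℕ} {Q Q' : RamState → Prop}
    (h : Runs p s T Q) (hT : T ≤ T') (hQ : ∀ s', SameOff p s s' → Q s' → Q' s') :
    Runs p s T' Q' := by
  obtain ⟨t, s', he, ht, hq⟩ := h
  exact ⟨t, s', he, ht.trans hT, hQ s' he.sameOff hq⟩

theorem Runs.seq {p q : RamProgram} {s : RamState} {T T' : ℕ} {P Q : RamState → Prop}
    (hp : Runs p s T P) (hq : ∀ s', SameOff p s s' → P s' → Runs q s' T' Q) :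
    Runs (p.seq q) s (T + T') Q := by
  obtain ⟨t, s', he, ht, h⟩ := hp
  obtain ⟨t', s'', he', ht', h'⟩ := hq s' he.sameOff h
  exact ⟨_, s'', he.seq he', by omega, h'⟩

theorem Runs.branch {x : ℕ} {p q : RamProgram} {s : RamState} {T : ℕ} {Q : RamState → Prop}
    (hp : s.reg x ≠ 0 → Runs p s T Q) (hq : s.reg x = 0 → Runs q s T Q) :
    Runs (.branch x p q) s (T + 1) Q := by
  by_cases h : s.reg x = 0
  · obtain ⟨t, s', he, ht, hQ⟩ := hq h
    exact ⟨_, s', .branch_false h he, by omega, hQ⟩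
  · obtain ⟨t, s', he, ht, hQ⟩ := hp h
    exact ⟨_, s', .branch_true h he, by omega, hQ⟩

/-- The program has no loops. -/
def RamProgram.loopFree : RamProgram → Bool
  | .seq p q => p.loopFree && q.loopFree
  | .branch _ p q => p.loopFree && q.loopFree
  | .loop _ _ => false
  | _ => true

/-- An upper bound for the number of steps of a loop-free program. -/
def RamProgram.cost : RamProgram → ℕ
  | .seq p q => p.cost + q.cost
  | .branch _ p q => p.cost + q.cost + 1
  | _ => 1

/-- The final state of a loop-free program. -/
def RamProgram.eval : RamProgram → RamState → RamState
  | .const d a, s => s.setReg d a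
  | .add d x y, s => s.setReg d (s.reg x + s.reg y)
  | .sub d x y, s => s.setReg d (s.reg x - s.reg y)
  | .load d A x, s => s.setReg d (s.arr A (s.reg x))
  | .store A x y, s => s.setArr A (s.reg x) (s.reg y)
  | .seq p q, s => q.eval (p.eval s)
  | .branch x p q, s => if s.reg x = 0 then q.eval s else p.eval s
  | .loop _ _, s => s

theorem RamProgram.runs_eval {p : RamProgram} (hp : p.loopFree = true) (s : RamState) :
    Runs p s p.cost (· = p.eval s) := by
  induction p generalizing s with
  | const d a => exact ⟨_, _, .const d a s, le_rfl, rfl⟩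
  | add d x y => exact ⟨_, _, .add d x y s, le_rfl, rfl⟩
  | sub d x y => exact ⟨_, _, .sub d x y s, le_rfl, rfl⟩
  | load d A x => exact ⟨_, _, .load d A x s, le_rfl, rfl⟩
  | store A x y => exact ⟨_, _, .store A x y s, le_rfl, rfl⟩
  | seq p q ihp ihq =>
    simp only [RamProgram.loopFree, Bool.and_eq_true] at hp
    exact (ihp hp.1 s).seq fun s' _ hs => by subst hs; exact ihq hp.2 _
  | branch x p q ihp ihq =>
    simp only [RamProgram.loopFree, Bool.and_eq_true] at hp
    exact Runs.branch
      (fun h => (ihp hp.1 s).mono (by omega) fun s' _ hs => by simp [hs, RamProgram.eval, h])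
      (fun h => (ihq hp.2 s).mono (by omega) fun s' _ hs => by simp [hs, RamProgram.eval, h])
  | loop x p => simp [RamProgram.loopFree] at hp

theorem Runs.of_eval {p : RamProgram} {s : RamState} {T : ℕ} {Q : RamState → Prop}
    (hp : p.loopFree = true) (hT : p.cost ≤ T) (hQ : Q (p.eval s)) : Runs p s T Q :=
  (p.runs_eval hp s).mono hT fun _ _ h => h ▸ hQ

/-! ### Derived loops

Register `2` is expected to hold `1` and register `3` to hold `0`. -/

/-- `for i := reg b - 1 downto 0 do body` -/
def forDown (i b : ℕ) (body : RamProgram) : RamProgram :=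
  .seq (.add i b 3) (.loop i (.seq (.sub i i 2) body))

/-- `Inv j` describes the state once the indices `j, ..., N - 1` are done. The counter is
decremented before the body, which therefore sees `N - 1, ..., 0`; `hset` makes the invariant
independent of the counter. Each round pays 2 for test and decrement. -/
theorem Runs.loopDown {i N T : ℕ} {body : RamProgram} {s₀ : RamState} (Inv : ℕ → RamState → Prop)
    (h1 : s₀.reg 2 = 1) (hi : body.writesReg i = false) (h2 : body.writesReg 2 = false)
    (hi2 : i ≠ 2)
    (hset : ∀ j s a, Inv j s → Inv j (s.setReg i a))
    (step : ∀ j < N, ∀ s, SameOff (.loop i (.seq (.sub i i 2) body)) s₀ s → s.reg i = j →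
      Inv (j + 1) s → Runs body s T (Inv j)) (M : ℕ) (hM : M ≤ N) (s : RamState)
    (hs : SameOff (.loop i (.seq (.sub i i 2) body)) s₀ s) (hsi : s.reg i = M) (hI : Inv M s) :
    Runs (.loop i (.seq (.sub i i 2) body)) s (M * (T + 2) + 1) (Inv 0) := by
  have hw2 : (RamProgram.loop i (.seq (.sub i i 2) body)).writesReg 2 = false := by
    simp [RamProgram.writesReg, h2, hi2]
  induction M generalizing s with
  | zero => exact ⟨1, s, .loop_done hsi, by omega, hI⟩
  | succ M ih =>
    have e1 := RamExec.sub i i 2 s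
    rw [hs.reg 2 hw2, h1, hsi, Nat.add_sub_cancel] at e1
    have hs1 : SameOff (.loop i (.seq (.sub i i 2) body)) s₀ (s.setReg i M) :=
      hs.trans (e1.sameOff.mono (by simp +contextual [RamProgram.writesReg])
        (by simp [RamProgram.writesArr]))
    obtain ⟨t, s', he, ht, hI'⟩ := step M (by omega) (s.setReg i M) hs1 (by simp [RamState.setReg])
      (hset _ _ _ hI)
    have hs' := he.sameOff
    obtain ⟨t', s'', he', ht', hQ⟩ := ih (by omega) s'
      (hs1.trans (hs'.mono (by simp +contextual [RamProgram.writesReg])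
        (by simp +contextual [RamProgram.writesArr])))
      (by rw [hs'.reg i hi]; simp [RamState.setReg]) hI'
    refine ⟨_, s'', .loop_step (by omega) (e1.seq he) he', ?_, hQ⟩
    have : (M + 1) * (T + 2) = M * (T + 2) + (T + 2) := by ring
    omega

theorem Runs.forDown {i b N T : ℕ} {body : RamProgram} {s : RamState} (Inv : ℕ → RamState → Prop)
    (h1 : s.reg 2 = 1) (h0 : s.reg 3 = 0) (hb : s.reg b = N) (hi : body.writesReg i = false)
    (h2 : body.writesReg 2 = false) (hi2 : i ≠ 2)
    (hset : ∀ j s a, Inv j s → Inv j (s.setReg i a)) (init : Inv N s)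
    (step : ∀ j < N, ∀ s', SameOff (forDown i b body) s s' → s'.reg i = j →
      Inv (j + 1) s' → Runs body s' T (Inv j)) :
    Runs (forDown i b body) s ((N + 1) * (T + 2)) (Inv 0) := by
  have e1 := RamExec.add i b 3 s
  rw [hb, h0, Nat.add_zero] at e1
  have hw (x : ℕ) : (_root_.forDown i b body).writesReg x =
      (RamProgram.loop i (.seq (.sub i i 2) body)).writesReg x := by
    simp [_root_.forDown, RamProgram.writesReg]
  have ha (A : ℕ) : (_root_.forDown i b body).writesArr A =
      (RamProgram.loop i (.seq (.sub i i 2) body)).writesArr A := by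
    simp [_root_.forDown, RamProgram.writesArr]
  obtain ⟨t, s', he, ht, hQ⟩ := Runs.loopDown (s₀ := s.setReg i N) Inv
    (by simp [RamState.setReg, hi2.symm, h1]) hi h2 hi2 hset
    (fun j hj s' hs' => step j hj s' (SameOff.trans
      (e1.sameOff.mono (by simp +contextual [_root_.forDown, RamProgram.writesReg])
        (by simp [RamProgram.writesArr]))
      (hs'.mono (fun x hx => hw x ▸ hx) (fun A hA => ha A ▸ hA))))
    N le_rfl _ (.refl _ _) (by simp [RamState.setReg]) (hset _ _ _ init)
  refine ⟨_, s', e1.seq he, ?_, hQ⟩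
  have : (N + 1) * (T + 2) = N * (T + 2) + (T + 2) := by ring
  omega

/-- Set `reg acc` to `1` if `body` leaves a nonzero value in register `t` for some `i < reg b`, and
to `0` otherwise. -/
def anyLoop (acc i b t : ℕ) (body : RamProgram) : RamProgram :=
  .seq (.const acc 0) (forDown i b (.seq body (.branch t (.const acc 1) (.const t 0))))

/-- `P` is enough for a hit and `Q` is what a hit proves. Keeping them apart lets the main search
have unrelated completeness and soundness conditions. -/
theorem Runs.anyLoop {acc i b t N T : ℕ} {body : RamProgram} {s : RamState} {P Q : ℕ → Prop}
    (h1 : s.reg 2 = 1) (h0 : s.reg 3 = 0) (hb : s.reg b = N)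
    (hw : (body.writesReg i || body.writesReg 2 || body.writesReg acc) = false)
    (hne : (acc == i || acc == 2 || acc == 3 || acc == b || acc == t || i == 2 || t == i ||
      t == 2) = false)
    (test : ∀ j < N, ∀ s', SameOff (anyLoop acc i b t body) s s' → s'.reg i = j →
      Runs body s' T (fun s'' => (P j → s''.reg t ≠ 0) ∧ (s''.reg t ≠ 0 → Q j))) :
    Runs (anyLoop acc i b t body) s ((N + 1) * (T + 6)) (fun s' =>
      ((∃ j < N, P j) → s'.reg acc ≠ 0) ∧ (s'.reg acc ≠ 0 → s'.reg acc = 1 ∧ ∃ j < N, Q j)) := by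
  simp only [Bool.or_eq_false_iff, beq_eq_false_iff_ne] at hw hne
  obtain ⟨⟨hwi, hw2⟩, hwa⟩ := hw
  obtain ⟨⟨⟨⟨⟨⟨⟨hai, ha2⟩, ha3⟩, hab⟩, hat⟩, hi2⟩, hti⟩, ht2⟩ := hne
  have e1 := RamExec.const acc 0 s
  set s₁ := s.setReg acc 0 with hs₁
  have key := Runs.forDown (s := s₁) (i := i) (b := b) (N := N) (T := T + 3)
    (body := .seq body (.branch t (.const acc 1) (.const t 0)))
    (fun m s' => ((∃ j, m ≤ j ∧ j < N ∧ P j) → s'.reg acc ≠ 0) ∧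
      (s'.reg acc ≠ 0 → s'.reg acc = 1 ∧ ∃ j, m ≤ j ∧ j < N ∧ Q j))
    (by simp [hs₁, RamState.setReg, ha2.symm, h1]) (by simp [hs₁, RamState.setReg, ha3.symm, h0])
    (by simp [hs₁, RamState.setReg, Ne.symm hab, hb])
    (by simp [RamProgram.writesReg, hwi, hai, hti])
    (by simp [RamProgram.writesReg, hw2, ha2, ht2]) hi2
    (by intro j s a h; simpa [RamState.setReg, hai] using h)
    (by
      refine ⟨?_, by simp [hs₁, RamState.setReg]⟩
      rintro ⟨j, h, h', -⟩
      omega)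
    (by
      intro j hj s' hs' hsi ⟨hI, hI'⟩
      have hs : SameOff (_root_.anyLoop acc i b t body) s s' :=
        (e1.sameOff.mono (by simp +contextual [_root_.anyLoop, RamProgram.writesReg])
          (by simp [RamProgram.writesArr])).trans
        (hs'.mono (by simp +contextual [_root_.anyLoop, RamProgram.writesReg])
          (by simp +contextual [_root_.anyLoop, RamProgram.writesArr]))
      refine (test j hj s' hs hsi).seq fun s'' hs'' ⟨h, h'⟩ => Runs.of_eval rfl le_rfl ?_
      have ha := hs''.reg acc hwa
      by_cases h0 : s''.reg t = 0
      · simp only [RamProgram.eval, h0, if_true, RamState.setReg, Function.update_of_ne hat, ha]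
        constructor
        · rintro ⟨l, hl, hlN, hP⟩
          refine hI ⟨l, ?_, hlN, hP⟩
          by_contra hlj
          obtain rfl : l = j := by omega
          exact h hP h0
        · intro hne
          obtain ⟨h1, l, hl, hlN, hP⟩ := hI' hne
          exact ⟨h1, l, by omega, hlN, hP⟩
      · simp only [RamProgram.eval, h0, if_false, RamState.setReg, Function.update_self]
        exact ⟨by simp, fun _ => ⟨trivial, j, le_rfl, hj, h' h0⟩⟩)
  obtain ⟨t', s', he, ht, hI, hI'⟩ := key
  refine ⟨_, s', e1.seq he, ?_, ?_, ?_⟩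
  -- Per round: `T` for the body, 3 for the branch, 2 for the loop. The remaining `N + 1` absorbs
  -- the initialisation.
  · have : (N + 1) * (T + 6) = (N + 1) * (T + 3 + 2) + (N + 1) := by ring
    omega
  · rintro ⟨j, hj, hP⟩
    exact hI ⟨j, by omega, hj, hP⟩
  · intro hne
    obtain ⟨h1, j, -, hj⟩ := hI' hne
    exact ⟨h1, j, hj⟩

/-- Set every entry `A[i]` with `i < reg b` to the value that `body` leaves in register `t`. -/
def fillLoop (A i b t : ℕ) (body : RamProgram) : RamProgram :=
  forDown i b (.seq body (.store A i t))

theorem Runs.fillLoop {A i b t N T : ℕ} {body : RamProgram} {s : RamState} {P : ℕ → Prop}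
    (h1 : s.reg 2 = 1) (h0 : s.reg 3 = 0) (hb : s.reg b = N)
    (hw : (body.writesReg i || body.writesReg 2 || body.writesArr A) = false) (hi2 : i ≠ 2)
    (test : ∀ j < N, ∀ s', SameOff (fillLoop A i b t body) s s' → s'.reg i = j →
      Runs body s' T (fun s'' => s''.reg t ≠ 0 ↔ P j)) :
    Runs (fillLoop A i b t body) s ((N + 1) * (T + 3)) (fun s' =>
      ∀ j < N, s'.arr A j ≠ 0 ↔ P j) := by
  simp only [Bool.or_eq_false_iff] at hw
  obtain ⟨⟨hwi, hw2⟩, hwA⟩ := hw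
  refine (Runs.forDown (N := N) (T := T + 1)
    (fun m s' => ∀ j, m ≤ j → j < N → (s'.arr A j ≠ 0 ↔ P j)) h1 h0 hb
    (by simp [RamProgram.writesReg, hwi]) (by simp [RamProgram.writesReg, hw2]) hi2
    (fun _ _ _ h => h) (fun j h h' => by omega) ?_).mono le_rfl
    (fun s' _ h j hj => h j (by omega) hj)
  intro j hj s' hs' hsi hI
  refine (test j hj s' hs' hsi).seq fun s'' hs'' h => Runs.of_eval rfl le_rfl fun l hl hlN => ?_
  simp only [RamProgram.eval, RamState.setArr, Function.update_self, hs''.reg i hwi, hsi]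
  rcases hl.eq_or_lt with rfl | hl
  · simpa using h
  · rw [Function.update_of_ne (by omega), hs''.arr A hwA]
    exact hI l hl hlN

/-! ### Connected sets and balls -/

section Combinatorics

set_option linter.unusedSectionVars false

variable {V : Type*} [Fintype V] [DecidableEq V] (G : SimpleGraph V)

/-- `A` is non-empty and every proper non-empty subset of `A` has an edge to the rest of `A`. -/
def IsConnectedSet (A : Finset V) : Prop :=
  A.Nonempty ∧ ∀ L ⊆ A, L.Nonempty → L ≠ A → ∃ l ∈ L, ∃ m ∈ A, m ∉ L ∧ G.Adj l m

/-- A walk from `L` to its complement crosses the boundary; conversely, the vertices reachable from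
`x` form a subset with no edge to the rest. The cut form suits all later arguments. -/
theorem induce_connected_iff (A : Finset V) :
    (G.induce (A : Set V)).Connected ↔ IsConnectedSet G A := by
  constructor
  · intro h
    have ⟨⟨a, ha⟩⟩ := h.nonempty
    refine ⟨⟨a, ha⟩, fun L hL ⟨l, hl⟩ hne => ?_⟩
    obtain ⟨m, hm, hmL⟩ : ∃ m ∈ A, m ∉ L := by
      by_contra! hcon
      exact hne (hL.antisymm hcon)
    obtain ⟨w⟩ := h.preconnected ⟨l, hL hl⟩ ⟨m, hm⟩
    obtain ⟨d, -, hd, hd'⟩ := w.exists_boundary_dart {x | (x : V) ∈ L} hl hmL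
    exact ⟨_, hd, _, d.snd.2, hd', d.adj⟩
  · rintro ⟨⟨a, ha⟩, h⟩
    have : Nonempty (A : Set V) := ⟨⟨a, ha⟩⟩
    refine ⟨fun x y => ?_⟩
    classical
    by_contra hxy
    obtain ⟨l, hl, m, hm, hmL, hadj⟩ := h
      (A.filter fun v => ∃ hv : v ∈ A, (G.induce (A : Set V)).Reachable x ⟨v, hv⟩)
      (Finset.filter_subset _ _) ⟨x, by simp⟩ (by
        intro he
        have hy := he.symm.subset (show (y : V) ∈ A from y.2)
        exact hxy (Finset.mem_filter.1 hy).2.2)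
    simp only [Finset.mem_filter] at hl hmL
    obtain ⟨-, hlA, hr⟩ := hl
    exact hmL ⟨hm, hm, hr.trans (SimpleGraph.Adj.reachable (by simpa using hadj))⟩

/-! ### Bounded reachability. -/

open Classical in
/-- `X` together with the neighbours of `X` in `D`. -/
noncomputable def expandSet (D X : Finset V) : Finset V :=
  X ∪ D.filter fun v => ∃ u ∈ X, G.Adj u v

/-- The vertices reached from `X` by at most `m` steps to vertices of `D`. -/
noncomputable def reachSet (D X : Finset V) (m : ℕ) : Finset V :=
  (expandSet G D)^[m] X

theorem mem_expandSet {D X : Finset V} {v : V} :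
    v ∈ expandSet G D X ↔ v ∈ X ∨ v ∈ D ∧ ∃ u ∈ X, G.Adj u v := by
  simp [expandSet]

theorem subset_expandSet (D X : Finset V) : X ⊆ expandSet G D X := fun _ h =>
  (mem_expandSet G).2 (.inl h)

theorem reachSet_succ (D X : Finset V) (m : ℕ) :
    reachSet G D X (m + 1) = expandSet G D (reachSet G D X m) :=
  Function.iterate_succ_apply' _ _ _

theorem reachSet_add (D X : Finset V) (a b : ℕ) :
    reachSet G D X (a + b) = reachSet G D (reachSet G D X a) b := by
  simp only [reachSet]
  rw [add_comm, Function.iterate_add_apply]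

theorem reachSet_mono {D D' X X' : Finset V} {m m' : ℕ} (hD : D ⊆ D') (hX : X ⊆ X')
    (hm : m ≤ m') : reachSet G D X m ⊆ reachSet G D' X' m' := by
  induction hm with
  | refl =>
    induction m with
    | zero => exact hX
    | succ m ih =>
      rw [reachSet_succ, reachSet_succ]
      intro v hv
      rw [mem_expandSet] at hv ⊢
      exact hv.imp (fun h => ih h) fun ⟨h, u, hu, huv⟩ => ⟨hD h, u, ih hu, huv⟩
  | step _ ih =>
    rw [reachSet_succ]
    exact ih.trans (subset_expandSet G _ _)

theorem subset_reachSet (D X : Finset V) (m : ℕ) : X ⊆ reachSet G D X m :=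
  reachSet_mono (m := 0) G subset_rfl subset_rfl m.zero_le

theorem reachSet_subset_of_closed {D X L : Finset V} (hX : X ⊆ L)
    (hL : ∀ l ∈ L, ∀ m ∈ D, G.Adj l m → m ∈ L) (m : ℕ) : reachSet G D X m ⊆ L := by
  induction m with
  | zero => exact hX
  | succ m ih =>
    rw [reachSet_succ]
    intro v hv
    rw [mem_expandSet] at hv
    exact hv.elim (fun h => ih h) fun ⟨h, u, hu, huv⟩ => hL u (ih hu) v h huv

variable {G}

/-- Until it exhausts `A`, the reached set gains a vertex in each step, so `A.card - 1` steps
suffice. -/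
theorem IsConnectedSet.subset_reachSet {A : Finset V} (hA : IsConnectedSet G A) {r : V}
    (hr : r ∈ A) {m : ℕ} (hm : A.card ≤ m + 1) : A ⊆ reachSet G A {r} m := by
  have key (m : ℕ) : A ⊆ reachSet G A {r} m ∨ m + 1 ≤ (reachSet G A {r} m).card := by
    induction m with
    | zero => simp [reachSet]
    | succ m ih =>
      rcases ih with ih | ih
      · exact .inl (ih.trans (reachSet_mono G subset_rfl subset_rfl (Nat.le_succ m)))
      by_cases he : reachSet G A {r} m = A
      · exact .inl (he.symm.subset.trans (reachSet_mono G subset_rfl subset_rfl (Nat.le_succ m)))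
      right
      obtain ⟨l, hl, v, hv, hvL, hadj⟩ := hA.2 (reachSet G A {r} m)
        (reachSet_subset_of_closed G (by simpa using hr) (fun _ _ _ h _ => h) m)
        ⟨r, _root_.subset_reachSet G _ _ _ (by simp)⟩ he
      refine Nat.succ_le_of_lt (ih.trans_lt (Finset.card_lt_card ?_))
      rw [reachSet_succ]
      refine (Finset.ssubset_iff_of_subset (subset_expandSet G _ _)).2 ⟨v, ?_, hvL⟩
      exact (mem_expandSet G).2 (.inr ⟨hv, l, hl, hadj⟩)
  refine (key m).elim id fun h => (Finset.eq_of_subset_of_card_le (reachSet_subset_of_closed G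
    (by simpa using hr) (fun _ _ _ h _ => h) m) (hm.trans h)).symm.subset

/-- A cut without crossing edges would trap the search on the side of `r`. -/
theorem isConnectedSet_of_subset_reachSet {A : Finset V} {r : V} (hr : r ∈ A) {m : ℕ}
    (h : A ⊆ reachSet G A {r} m) : IsConnectedSet G A := by
  refine ⟨⟨r, hr⟩, fun L hL ⟨l, hl⟩ hne => ?_⟩
  by_contra! hcon
  by_cases hrL : r ∈ L
  · refine hne (hL.antisymm (h.trans (reachSet_subset_of_closed G (by simpa using hrL) ?_ m)))
    intro l hl m hm hadj
    by_contra hmL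
    exact hcon l hl m hm hmL hadj
  · have := (h.trans (reachSet_subset_of_closed G (L := A \ L) (by simp [hr, hrL]) ?_ m)) (hL hl)
    · simp [hl] at this
    intro a ha b hb hadj
    simp only [Finset.mem_sdiff] at ha ⊢
    exact ⟨hb, fun hbL => hcon b hbL a ha.1 ha.2 hadj.symm⟩

theorem isConnectedSet_iff_subset_reachSet {A : Finset V} {r : V} (hr : r ∈ A) :
    IsConnectedSet G A ↔ A ⊆ reachSet G A {r} (Fintype.card V) :=
  ⟨fun h => h.subset_reachSet hr (A.card_le_univ.trans (Nat.le_succ _)),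
    isConnectedSet_of_subset_reachSet hr⟩

/-! ### Balls and their sizes. -/

variable (G)

/-- The vertices at distance at most `m` from `x`. -/
noncomputable def ballSet (x : V) (m : ℕ) : Finset V := reachSet G Finset.univ {x} m

theorem self_mem_ballSet (x : V) (m : ℕ) : x ∈ ballSet G x m :=
  subset_reachSet G _ _ _ (by simp)

variable {G}

theorem mem_ballSet_succ {x y z : V} {m : ℕ} (hy : y ∈ ballSet G x m) (h : G.Adj y z) :
    z ∈ ballSet G x (m + 1) := by
  rw [ballSet, reachSet_succ]
  exact (mem_expandSet G).2 (.inr ⟨Finset.mem_univ _, y, hy, h⟩)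

theorem ballSet_mono {x : V} {m m' : ℕ} (h : m ≤ m') : ballSet G x m ⊆ ballSet G x m' :=
  reachSet_mono G subset_rfl subset_rfl h

theorem ballSet_subset_ballSet {x y : V} {a b c : ℕ} (hy : y ∈ ballSet G x a) (h : a + b ≤ c) :
    ballSet G y b ⊆ ballSet G x c := by
  refine .trans ?_ (ballSet_mono h)
  rw [ballSet, ballSet, reachSet_add]
  exact reachSet_mono G subset_rfl (Finset.singleton_subset_iff.2 hy) le_rfl

/-- The source of all lower bounds on sizes: a connected set containing two vertices at distance
more than `m` has more than `m` vertices. -/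
theorem IsConnectedSet.lt_card_of_notMem_ballSet {A : Finset V} (hA : IsConnectedSet G A) {x y : V}
    (hx : x ∈ A) (hy : y ∈ A) {m : ℕ} (h : y ∉ ballSet G x m) : m < A.card := by
  by_contra! hm
  exact h (reachSet_mono G (Finset.subset_univ _) subset_rfl le_rfl
    (hA.subset_reachSet hx (by omega) hy))

theorem card_reachSet_le [DecidableRel G.Adj] (D X : Finset V) (m : ℕ) :
    (reachSet G D X m).card ≤ (G.maxDegree + 1) ^ m * X.card := by
  induction m with
  | zero => simp [reachSet]
  | succ m ih =>
    have h : expandSet G D (reachSet G D X m) ⊆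
        (reachSet G D X m).biUnion fun u => insert u (G.neighborFinset u) := by
      intro v hv
      rw [mem_expandSet] at hv
      simp only [Finset.mem_biUnion, Finset.mem_insert, SimpleGraph.mem_neighborFinset]
      exact hv.elim (fun h => ⟨v, h, .inl rfl⟩) fun ⟨_, u, hu, huv⟩ => ⟨u, hu, .inr huv⟩
    rw [reachSet_succ]
    refine (Finset.card_le_card h).trans ((Finset.card_biUnion_le_card_mul _ _
      (G.maxDegree + 1) fun u _ => ?_).trans ?_)
    · refine (Finset.card_insert_le _ _).trans ?_
      rw [SimpleGraph.card_neighborFinset_eq_degree]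
      exact Nat.succ_le_succ (G.degree_le_maxDegree u)
    · calc _ ≤ ((G.maxDegree + 1) ^ m * X.card) * (G.maxDegree + 1) := Nat.mul_le_mul_right _ ih
        _ = _ := by ring

/-! ### Components of the complement of a vertex -/

variable (G)

/-- `L` is the vertex set of a connected component of `G[E]`. -/
structure IsComponentOf (E L : Finset V) : Prop where
  subset : L ⊆ E
  connected : IsConnectedSet G L
  closed : ∀ l ∈ L, ∀ m ∈ E, G.Adj l m → m ∈ L

/-- Take a minimal closed subset containing `v`: a cut `K` of it without crossing edges would make
`K` or `L \ K` a smaller one. -/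
theorem exists_isComponentOf {E : Finset V} {v : V} (hv : v ∈ E) :
    ∃ L, IsComponentOf G E L ∧ v ∈ L := by
  classical
  obtain ⟨L, hvL, hmin⟩ := (Finset.univ.filter fun L : Finset V =>
    L ⊆ E ∧ v ∈ L ∧ ∀ l ∈ L, ∀ m ∈ E, G.Adj l m → m ∈ L).exists_minimal
      ⟨E, by simpa using ⟨hv, fun _ _ _ h _ => h⟩⟩
  simp only [Finset.mem_filter, Finset.mem_univ, true_and] at hvL hmin
  obtain ⟨hLE, hvL, hcl⟩ := hvL
  refine ⟨L, ⟨hLE, ⟨⟨v, hvL⟩, fun K hK hKn hne => ?_⟩, hcl⟩, hvL⟩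
  by_contra! hcon
  by_cases hvK : v ∈ K
  · refine hne (hK.antisymm (hmin ⟨hK.trans hLE, hvK, fun l hl m hm hadj => ?_⟩ hK))
    by_contra hmK
    exact hcon l hl m (hcl l (hK hl) m hm hadj) hmK hadj
  · obtain ⟨a, ha⟩ := hKn
    have := hmin (y := L \ K) ⟨Finset.sdiff_subset.trans hLE, by simp [hvL, hvK],
      fun l hl m hm hadj => ?_⟩ Finset.sdiff_subset (hK ha)
    · simp [ha] at this
    · simp only [Finset.mem_sdiff] at hl ⊢
      exact ⟨hcl l hl.1 m hm hadj, fun hmK => hcon m hmK l hl.1 hl.2 hadj.symm⟩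

variable {G}

theorem IsConnectedSet.subset_of_isComponentOf {E L A : Finset V} (hA : IsConnectedSet G A)
    (hL : IsComponentOf G E L) (hAE : A ⊆ E) {a : V} (ha : a ∈ A) (haL : a ∈ L) : A ⊆ L := by
  by_contra hsub
  obtain ⟨l, hl, m, hm, hmL, hadj⟩ := hA.2 (A ∩ L) Finset.inter_subset_left
    ⟨a, by simp [ha, haL]⟩ (fun h => hsub (Finset.inter_eq_left.1 h))
  simp only [Finset.mem_inter] at hl hmL
  exact hmL ⟨hm, hL.closed l hl.2 m (hAE hm) hadj⟩

theorem exists_isComponentOf_notMem {E : Finset V} (hE : E.Nonempty) (h : ¬ IsConnectedSet G E)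
    (z : V) : ∃ L, IsComponentOf G E L ∧ z ∉ L := by
  by_cases hz : z ∈ E
  · obtain ⟨K, hK, hzK⟩ := exists_isComponentOf G hz
    have hne : K ≠ E := fun he => h (he ▸ hK.connected)
    obtain ⟨v, hv, hvK⟩ : ∃ v ∈ E, v ∉ K := by
      by_contra! hcon
      exact hne (hK.subset.antisymm hcon)
    obtain ⟨L, hL, hvL⟩ := exists_isComponentOf G hv
    refine ⟨L, hL, fun hzL => hvK ?_⟩
    exact hL.connected.subset_of_isComponentOf hK hL.subset hzL hzK hvL
  · obtain ⟨v, hv⟩ := hE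
    obtain ⟨L, hL, -⟩ := exists_isComponentOf G hv
    exact ⟨L, hL, fun h => hz (hL.subset h)⟩

/-! ### Tight vertices -/

variable [DecidableRel G.Adj]

variable (G) in
/-- `v` is protected in `D`. -/
def IsProtected (D : Finset V) (v : V) : Prop :=
  (G.neighborFinset v \ D).card ≤ (insert v (G.neighborFinset v) ∩ D).card

theorem isConnectedDefensiveAlliance_iff {D : Finset V} :
    IsConnectedDefensiveAlliance G D ↔ IsConnectedSet G D ∧ ∀ v ∈ D, IsProtected G D v := by
  rw [IsConnectedDefensiveAlliance, induce_connected_iff]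
  exact ⟨fun h => ⟨h.2, h.1.2⟩, fun h => ⟨⟨h.1.1, h.2⟩, h.1⟩⟩

theorem isProtected_iff {D : Finset V} {v : V} (hv : v ∈ D) :
    IsProtected G D v ↔ (G.neighborFinset v \ D).card ≤ (G.neighborFinset v ∩ D).card + 1 := by
  rw [IsProtected, Finset.insert_inter_of_mem hv, Finset.card_insert_of_notMem (by simp)]

theorem isProtected_congr {D D' : Finset V} {v : V} (hv : v ∈ D) (hv' : v ∈ D')
    (h : ∀ w, G.Adj v w → (w ∈ D ↔ w ∈ D')) : IsProtected G D v ↔ IsProtected G D' v := by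
  have h1 : G.neighborFinset v \ D = G.neighborFinset v \ D' := by
    ext w
    simp only [Finset.mem_sdiff, SimpleGraph.mem_neighborFinset]
    exact and_congr_right fun hw => not_congr (h w hw)
  have h2 : G.neighborFinset v ∩ D = G.neighborFinset v ∩ D' := by
    ext w
    simp only [Finset.mem_inter, SimpleGraph.mem_neighborFinset]
    exact and_congr_right fun hw => h w hw
  rw [isProtected_iff hv, isProtected_iff hv', h1, h2]

variable (G) in
/-- `u` is a vertex of `D` that is not protected any more once a neighbour is removed. -/
def IsTight (D : Finset V) (u : V) : Prop :=
  u ∈ D ∧ ∀ v ∈ D, G.Adj u v → ¬ IsProtected G (D.erase v) u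

/-- The protection of `u` after losing a neighbour depends only on two cardinalities, not on which
neighbour is lost. One fatal removal therefore makes all of them fatal. -/
theorem IsProtected.adj_and_isTight {D : Finset V} {u v : V} (hu : IsProtected G D u)
    (hv : v ∈ D) (huv : u ∈ D.erase v) (h : ¬ IsProtected G (D.erase v) u) :
    G.Adj u v ∧ IsTight G D u := by
  have huD := Finset.mem_of_mem_erase huv
  have hadj : G.Adj u v := by
    by_contra hna
    refine h ((isProtected_congr huv huD fun w hw => ?_).2 hu)
    rw [Finset.mem_erase, and_iff_right]
    rintro rfl
    exact hna hw
  have key (w : V) (hw : w ∈ D) (huw : G.Adj u w) : IsProtected G (D.erase w) u ↔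
      (G.neighborFinset u \ D).card + 1 ≤ (G.neighborFinset u ∩ D).card := by
    rw [isProtected_iff (Finset.mem_erase.2 ⟨huw.ne, huD⟩)]
    have h1 : G.neighborFinset u \ D.erase w = insert w (G.neighborFinset u \ D) := by
      ext z
      simp only [Finset.mem_sdiff, SimpleGraph.mem_neighborFinset, Finset.mem_erase,
        Finset.mem_insert]
      by_cases hz : z = w
      · simp [hz, huw]
      · simp [hz]
    have h2 : G.neighborFinset u ∩ D.erase w = (G.neighborFinset u ∩ D).erase w := by
      ext z
      simp only [Finset.mem_inter, SimpleGraph.mem_neighborFinset, Finset.mem_erase]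
      tauto
    have h3 : w ∈ G.neighborFinset u ∩ D := by simp [huw, hw]
    rw [h1, h2, Finset.card_insert_of_notMem (by simp [hw]), Finset.card_erase_add_one h3]
  exact ⟨hadj, huD, fun w hw huw => by rwa [key w hw huw, ← key v hv hadj]⟩

/-- Connectivity is not what fails when `v` is removed, so some vertex becomes unprotected. -/
theorem IsConnectedLocallyMinimalDefensiveAlliance.exists_isTight {D : Finset V}
    (hD : IsConnectedLocallyMinimalDefensiveAlliance G D) {v : V} (hv : v ∈ D)
    (hc : IsConnectedSet G (D.erase v)) : ∃ u, G.Adj v u ∧ IsTight G D u := by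
  have h := hD.2 v hv
  rw [isConnectedDefensiveAlliance_iff] at h
  push Not at h
  obtain ⟨u, hu, hnp⟩ := h hc
  have hp := (isConnectedDefensiveAlliance_iff.1 hD.1).2 u (Finset.mem_of_mem_erase hu)
  have := hp.adj_and_isTight hv hu hnp
  exact ⟨u, this.1.symm, this.2⟩

/-! ### Vertices that survive every shrinking -/

variable (G) in
/-- `D` has two adjacent tight vertices, one of which is adjacent to `v`, or a tight cut vertex that
is adjacent to `v` and to all vertices of some component of the rest of `D`. -/
def IsKept (D : Finset V) (v : V) : Prop :=
  v ∈ D ∧ ((∃ u u', IsTight G D u ∧ IsTight G D u' ∧ G.Adj u u' ∧ G.Adj u v) ∨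
    ∃ c L, IsTight G D c ∧ IsComponentOf G (D.erase c) L ∧ L ≠ D.erase c ∧
      (∀ l ∈ L, G.Adj c l) ∧ G.Adj c v)

/-- Induction on the size of `L`. A cut vertex `c'` in `L` splits off a component lying strictly
inside `L`. Otherwise every vertex of `L` has a tight neighbour in `L` or equal to `c`: a tight
vertex in `L` gives an adjacent tight pair, and if there is none, `c` is tight and adjacent to all
of `L`. -/
theorem exists_isKept_of_isComponentOf {D : Finset V}
    (hD : IsConnectedLocallyMinimalDefensiveAlliance G D) {c : V} (hc : c ∈ D) {L : Finset V}
    (hL : IsComponentOf G (D.erase c) L) (hne : L ≠ D.erase c) : ∃ v ∈ L, IsKept G D v := by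
  have hconn := (isConnectedDefensiveAlliance_iff.1 hD.1).1
  induction hn : L.card using Nat.strong_induction_on generalizing c L with
  | _ n ih =>
  have hLD : ∀ v ∈ L, v ∈ D := fun v hv => Finset.mem_of_mem_erase (hL.subset hv)
  have hcL : c ∉ L := fun h => by simpa using hL.subset h
  by_cases hcut : ∃ c' ∈ L, ¬ IsConnectedSet G (D.erase c')
  · obtain ⟨c', hc', hcut⟩ := hcut
    have hcc' : c ≠ c' := fun h => hcL (h ▸ hc')
    obtain ⟨L', hL', hcL'⟩ := exists_isComponentOf_notMem
      ⟨c, Finset.mem_erase.2 ⟨hcc', hc⟩⟩ hcut c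
    have hc'L' : c' ∉ L' := fun h => by simpa using hL'.subset h
    have hL'D : L' ⊆ D := hL'.subset.trans (Finset.erase_subset _ _)
    have hL'E : L' ⊆ D.erase c := fun v hv =>
      Finset.mem_erase.2 ⟨fun h => hcL' (h ▸ hv), hL'D hv⟩
    obtain ⟨l, hl, m, hm, hmL', hadj⟩ := hconn.2 L' hL'D hL'.connected.1
      (fun h => hcL' (h ▸ hc))
    -- An edge leaving the component `L'` inside `D` can only end in `c'`. Its other end is then a
    -- neighbour of a vertex of `L`, which places `L'` inside `L`.
    obtain rfl : m = c' := by
      by_contra hmc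
      exact hmL' (hL'.closed l hl m (Finset.mem_erase.2 ⟨hmc, hm⟩) hadj)
    have hlL : l ∈ L := hL.closed m hc' l (hL'E hl) hadj.symm
    have hsub : L' ⊆ L := hL'.connected.subset_of_isComponentOf hL hL'E hl hlL
    obtain ⟨v, hv, hk⟩ := ih L'.card (hn ▸ Finset.card_lt_card
      ((Finset.ssubset_iff_of_subset hsub).2 ⟨m, hc', hc'L'⟩)) (hLD m hc') hL'
      (fun h => hcL' (h ▸ Finset.mem_erase.2 ⟨hcc', hc⟩)) rfl
    exact ⟨v, hsub hv, hk⟩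
  · push Not at hcut
    by_cases hu : ∃ u ∈ L, IsTight G D u
    · obtain ⟨u, huL, hu⟩ := hu
      obtain ⟨u', hadj, hu'⟩ := hD.exists_isTight (hLD u huL) (hcut u huL)
      exact ⟨u, huL, hLD u huL, .inl ⟨u', u, hu', hu, hadj.symm, hadj.symm⟩⟩
    · push Not at hu
      have key : ∀ v ∈ L, IsTight G D c ∧ G.Adj c v := fun v hv => by
        obtain ⟨u, hadj, hut⟩ := hD.exists_isTight (hLD v hv) (hcut v hv)
        have : u = c := by
          by_contra huc
          exact hu u (hL.closed v hv u (Finset.mem_erase.2 ⟨huc, hut.1⟩) hadj) hut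
        exact this ▸ ⟨hut, hadj.symm⟩
      obtain ⟨v, hv⟩ := hL.connected.1
      exact ⟨v, hv, hLD v hv, .inr ⟨c, L, (key v hv).1, hL, hne, fun l hl => (key l hl).2,
        (key v hv).2⟩⟩

/-! ### Shrinking sequences and the persistence of kept vertices. -/

variable (G) in
/-- `D'` arises from `D` by removing vertices one by one, through connected defensive alliances. -/
def ShrinksTo : Finset V → Finset V → Prop :=
  Relation.ReflTransGen fun A A' =>
    ∃ v ∈ A, A' = A.erase v ∧ IsConnectedDefensiveAlliance G A'

theorem ShrinksTo.subset {A A' : Finset V} (h : ShrinksTo G A A') : A' ⊆ A := by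
  induction h with
  | refl => exact subset_rfl
  | tail _ h ih =>
    obtain ⟨v, -, rfl, -⟩ := h
    exact (Finset.erase_subset _ _).trans ih

theorem ShrinksTo.isConnectedDefensiveAlliance {A A' : Finset V} (h : ShrinksTo G A A')
    (hA : IsConnectedDefensiveAlliance G A) : IsConnectedDefensiveAlliance G A' := by
  induction h with
  | refl => exact hA
  | tail _ h _ =>
    obtain ⟨v, -, rfl, h⟩ := h
    exact h

theorem ShrinksTo.eq_of_minimal {A A' : Finset V} (h : ShrinksTo G A A')
    (hA : ∀ v ∈ A, ¬ IsConnectedDefensiveAlliance G (A.erase v)) : A' = A := by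
  induction h with
  | refl => rfl
  | tail _ h ih =>
    obtain ⟨v, hv, rfl, h⟩ := h
    subst ih
    exact (hA v hv h).elim

/-- Tightness in `D` carries over to any set that agrees with `D` on the neighbourhood of `u`. -/
theorem IsTight.ne_of_isProtected {D A : Finset V} {u z : V} (hu : IsTight G D u)
    (huA : u ∈ A) (hN : ∀ w, G.Adj u w → (w ∈ A ↔ w ∈ D)) (hzD : z ∈ D) (huz : G.Adj u z)
    (h : IsConnectedDefensiveAlliance G (A.erase z)) : False := by
  have huz' : u ∈ A.erase z := Finset.mem_erase.2 ⟨huz.ne, huA⟩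
  refine hu.2 z hzD huz ((isProtected_congr (Finset.mem_erase.2 ⟨huz.ne, hu.1⟩) huz'
    fun w hw => ?_).2 ((isConnectedDefensiveAlliance_iff.1 h).2 u huz'))
  rw [Finset.mem_erase, Finset.mem_erase, hN w hw]

/-- `B` is a region where `D₀` has nothing outside `D`. The whole pattern persists, by induction
along the sequence: while the `D`-neighbours of a tight vertex are all present, none of them can be
the first to go. Two adjacent tight vertices guard each other; a tight cut vertex cannot go because
this would disconnect the set. -/
theorem IsKept.mem_of_shrinksTo {D D₀ A B : Finset V} {v : V} (hv : IsKept G D v)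
    (hconn : IsConnectedSet G D) (hD : D ⊆ D₀) (hB : ∀ w ∈ D₀, w ∈ B → w ∈ D)
    (hvB : ballSet G v 3 ⊆ B) (h : ShrinksTo G D₀ A) : v ∈ A := by
  have hv0 := self_mem_ballSet G v 0
  obtain ⟨hvD, ⟨u, u', hu, hu', huu', huv⟩ | ⟨c, L, hc, hL, hne, hcL, hcv⟩⟩ := hv
  · suffices key : ∀ w ∈ D, G.Adj u w ∨ G.Adj u' w → w ∈ A from key v hvD (.inl huv)
    -- The radius 3 comes from the path from `v` over `u` and `u'` to a neighbour of `u'`.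
    have b1 := mem_ballSet_succ hv0 huv.symm
    have b2 := mem_ballSet_succ b1 huu'
    have hBu : ∀ w, G.Adj u w ∨ G.Adj u' w → w ∈ B := fun w hw => hvB (hw.elim
      (fun h => ballSet_mono (by omega) (mem_ballSet_succ b1 h)) fun h => mem_ballSet_succ b2 h)
    induction h with
    | refl => exact fun w hw _ => hD hw
    | tail h1 h2 ih =>
      obtain ⟨z, hz, rfl, hcda⟩ := h2
      have hsub := ShrinksTo.subset h1
      have hN : ∀ w, G.Adj u w ∨ G.Adj u' w → (w ∈ _ ↔ w ∈ D) := fun w hw =>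
        ⟨fun hwA => hB w (hsub hwA) (hBu w hw), fun hwD => ih w hwD hw⟩
      refine fun w hw hadj => Finset.mem_erase.2 ⟨?_, ih w hw hadj⟩
      rintro rfl
      rcases hadj with hadj | hadj
      · exact hu.ne_of_isProtected (ih u hu.1 (.inr huu'.symm)) (fun w hw => hN w (.inl hw)) hw
          hadj hcda
      · exact hu'.ne_of_isProtected (ih u' hu'.1 (.inl huu')) (fun w hw => hN w (.inr hw)) hw
          hadj hcda
  · suffices key : c ∈ A ∧ ∀ w ∈ D, G.Adj c w → w ∈ A from key.2 v hvD hcv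
    have b1 := mem_ballSet_succ hv0 hcv.symm
    have hBc : ∀ w, G.Adj c w → w ∈ B := fun w hw =>
      hvB (ballSet_mono (by omega) (mem_ballSet_succ b1 hw))
    have hcnL : c ∉ L := fun h => by simpa using hL.subset h
    have hLD : L ⊆ D := hL.subset.trans (Finset.erase_subset _ _)
    -- `m₀` is a neighbour of `c` on the other side of the cut. It stays as well, so removing `c`
    -- would leave both sides non-empty.
    obtain ⟨m₀, hm₀, hm₀L, hm₀c⟩ : ∃ m ∈ D, m ∉ L ∧ G.Adj c m := by
      obtain ⟨l, hl, m, hm, hmL, hadj⟩ := hconn.2 (insert c L)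
        (Finset.insert_subset hc.1 hLD) ⟨c, by simp⟩ (fun h => hne (by
          rw [← h, Finset.erase_insert hcnL]))
      simp only [Finset.mem_insert, not_or] at hl hmL
      refine ⟨m, hm, hmL.2, ?_⟩
      rcases hl with rfl | hl
      · exact hadj
      · exact (hmL.2 (hL.closed l hl m (Finset.mem_erase.2 ⟨hmL.1, hm⟩) hadj)).elim
    induction h with
    | refl => exact ⟨hD hc.1, fun w hw _ => hD hw⟩
    | tail h1 h2 ih =>
      obtain ⟨z, hz, rfl, hcda⟩ := h2
      have hsub := ShrinksTo.subset h1
      have hN : ∀ w, G.Adj c w → (w ∈ _ ↔ w ∈ D) := fun w hw =>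
        ⟨fun hwA => hB w (hsub hwA) (hBc w hw), fun hwD => ih.2 w hwD hw⟩
      refine ⟨Finset.mem_erase.2 ⟨?_, ih.1⟩, fun w hw hadj =>
        Finset.mem_erase.2 ⟨?_, ih.2 w hw hadj⟩⟩
      · rintro rfl
        obtain ⟨l, hl, m, hm, hmL, hadj⟩ := (isConnectedDefensiveAlliance_iff.1 hcda).1.2 L
          (fun l hl => Finset.mem_erase.2 ⟨fun h => hcnL (h ▸ hl), ih.2 l (hLD hl) (hcL l hl)⟩)
          hL.connected.1
          (fun h => hm₀L (h ▸ Finset.mem_erase.2 ⟨hm₀c.ne', ih.2 m₀ hm₀ hm₀c⟩))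
        rw [Finset.mem_erase] at hm
        -- The vertex beyond an edge leaving `L` is within distance 3 of `v`, hence belongs to `D`;
        -- the closedness of `L` then gives the contradiction.
        have hmB : m ∈ B := hvB (mem_ballSet_succ (mem_ballSet_succ b1 (hcL l hl)) hadj)
        exact hmL (hL.closed l hl m (Finset.mem_erase.2 ⟨hm.1, hB m (hsub hm.2) hmB⟩) hadj)
      · rintro rfl
        exact hc.ne_of_isProtected ih.1 hN hw hadj hcda

/-! ### Large locally minimal alliances are visible in two balls -/

theorem IsConnectedLocallyMinimalDefensiveAlliance.mem_or_isKept {D : Finset V}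
    (hD : IsConnectedLocallyMinimalDefensiveAlliance G D) {v : V} (hv : v ∈ D) :
    ¬ IsConnectedSet G (D.erase v) ∨ IsKept G D v ∨
      ∃ u ∈ D, G.Adj u v ∧ ¬ IsConnectedSet G (D.erase u) := by
  by_cases hc : IsConnectedSet G (D.erase v)
  · obtain ⟨u, hadj, hu⟩ := hD.exists_isTight hv hc
    by_cases hcu : IsConnectedSet G (D.erase u)
    · obtain ⟨u', hadj', hu'⟩ := hD.exists_isTight hu.1 hcu
      exact .inr (.inl ⟨hv, .inl ⟨u, u', hu, hu', hadj', hadj.symm⟩⟩)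
    · exact .inr (.inr ⟨u, hu.1, hadj.symm, hcu⟩)
  · exact .inl hc

theorem exists_isKept {D : Finset V}
    (hD : IsConnectedLocallyMinimalDefensiveAlliance G D) (h2 : 1 < D.card) :
    ∃ x, IsKept G D x := by
  have key (c : V) (hc : c ∈ D) (hcut : ¬ IsConnectedSet G (D.erase c)) : ∃ x, IsKept G D x := by
    have hne : (D.erase c).Nonempty := by
      rw [← Finset.card_pos, Finset.card_erase_of_mem hc]
      omega
    obtain ⟨L, hL, -⟩ := exists_isComponentOf_notMem hne hcut c
    obtain ⟨v, -, hv⟩ := exists_isKept_of_isComponentOf hD hc hL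
      (fun h => hcut (h ▸ hL.connected))
    exact ⟨v, hv⟩
  obtain ⟨v, hv⟩ := hD.1.1.1
  obtain h | h | ⟨u, hu, -, h⟩ := hD.mem_or_isKept hv
  · exact key v hv h
  · exact ⟨v, h⟩
  · exact key u hu h

/-- `F` consists of the vertices of the balls outside `D`, so `D₀` has no vertex outside `D` there.
For `D.card ≤ 1` the empty `F` works because alliances are non-empty. -/
theorem exists_forbidden_set {D : Finset V}
    (hD : IsConnectedLocallyMinimalDefensiveAlliance G D) {k : ℕ} (hk : k ≤ D.card) :
    ∃ x ∈ D, ∃ y, ∃ F, F ⊆ ballSet G x (k + 5) ∪ ballSet G y (k + 5) ∧ Disjoint D F ∧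
      ∀ D₀ A, IsConnectedDefensiveAlliance G D₀ → D ⊆ D₀ → Disjoint D₀ F → ShrinksTo G D₀ A →
        k ≤ A.card := by
  have hconn := (isConnectedDefensiveAlliance_iff.1 hD.1).1
  rcases lt_or_ge 1 D.card with h2 | h2
  swap
  · obtain ⟨v, hv⟩ := hD.1.1.1
    refine ⟨v, hv, v, ∅, by simp, by simp, fun D₀ A h0 _ _ hA => hk.trans (h2.trans ?_)⟩
    exact Finset.card_pos.2 (hA.isConnectedDefensiveAlliance h0).1.1
  obtain ⟨x, hx⟩ := exists_isKept hD h2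
  have hB {B D₀ : Finset V} (h : Disjoint D₀ (B \ D)) : ∀ w ∈ D₀, w ∈ B → w ∈ D := by
    intro w hw hwB
    by_contra hwD
    exact Finset.disjoint_left.1 h hw (Finset.mem_sdiff.2 ⟨hwB, hwD⟩)
  by_cases hfar : ∃ y, IsKept G D y ∧ y ∉ ballSet G x k
  · obtain ⟨y, hy, hyx⟩ := hfar
    refine ⟨x, hx.1, y, (ballSet G x (k + 5) ∪ ballSet G y (k + 5)) \ D, Finset.sdiff_subset,
      Finset.disjoint_sdiff, fun D₀ A h0 hDD hF hA => ?_⟩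
    have hxA := hx.mem_of_shrinksTo hconn hDD (hB hF)
      ((ballSet_mono (by omega)).trans Finset.subset_union_left) hA
    have hyA := hy.mem_of_shrinksTo hconn hDD (hB hF)
      ((ballSet_mono (by omega)).trans Finset.subset_union_right) hA
    exact ((isConnectedDefensiveAlliance_iff.1 (hA.isConnectedDefensiveAlliance h0)).1
      |>.lt_card_of_notMem_ballSet hxA hyA hyx).le
  push Not at hfar
  refine ⟨x, hx.1, x, ballSet G x (k + 5) \ D,
    Finset.sdiff_subset.trans Finset.subset_union_left,
    Finset.disjoint_sdiff, fun D₀ A h0 hDD hF hA => ?_⟩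
  have hAconn := (isConnectedDefensiveAlliance_iff.1 (hA.isConnectedDefensiveAlliance h0)).1
  have hkA : ∀ y, IsKept G D y → y ∈ A := fun y hy => hy.mem_of_shrinksTo hconn hDD (hB hF)
    (ballSet_subset_ballSet (hfar y hy) (by omega)) hA
  -- All kept vertices are now within distance `k` of `x`, and all lie in `A`. If `A` leaves the
  -- ball of radius `k + 3` it is large; otherwise `A ⊆ D`.
  by_cases hout : A ⊆ ballSet G x (k + 3)
  swap
  · obtain ⟨z, hz, hzx⟩ := Finset.not_subset.1 hout
    have := hAconn.lt_card_of_notMem_ballSet (hkA x hx) hz hzx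
    omega
  have hAD : A ⊆ D := fun w hw => hB hF w (hA.subset hw) (ballSet_mono (by omega) (hout hw))
  -- A cut vertex `c` further away would be missing from `A`. A component of the rest of `D` without
  -- `x` has a kept vertex, so the connected set `A` would join two components.
  have hcut : ∀ c ∈ D, ¬ IsConnectedSet G (D.erase c) → c ∈ ballSet G x (k + 3) := by
    intro c hc hnc
    by_contra hcb
    have hAE : A ⊆ D.erase c := fun w hw =>
      Finset.mem_erase.2 ⟨fun h => hcb (hout (h ▸ hw)), hAD hw⟩
    obtain ⟨L, hL, hxL⟩ := exists_isComponentOf_notMem ⟨x, hAE (hkA x hx)⟩ hnc x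
    obtain ⟨y, hyL, hy⟩ := exists_isKept_of_isComponentOf hD hc hL
      (fun h => hnc (h ▸ hL.connected))
    exact hxL (hAconn.subset_of_isComponentOf hL hAE (hkA y hy) hyL (hkA x hx))
  have hDb : D ⊆ ballSet G x (k + 4) := by
    intro v hv
    obtain h | h | ⟨u, hu, huv, h⟩ := hD.mem_or_isKept hv
    · exact ballSet_mono (by omega) (hcut v hv h)
    · exact ballSet_mono (by omega) (hfar v h)
    · exact mem_ballSet_succ (hcut u hu h) huv
  -- An edge of `D₀` leaving `D` would end within distance `k + 5` of `x`, where `D₀` has no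
  -- vertices outside `D`. This fixes the radius.
  have hD0 : D₀ = D := by
    by_contra hne
    obtain ⟨l, hl, m, hm, hmD, hadj⟩ := (isConnectedDefensiveAlliance_iff.1 h0).1.2 D hDD hD.1.1.1
      (Ne.symm hne)
    exact hmD (hB hF m hm (mem_ballSet_succ (hDb hl) hadj))
  subst hD0
  rwa [hA.eq_of_minimal hD.2]

end Combinatorics

/-! ### Subroutines -/

/-- Register `0` holds `n`, registers `2` and `3` hold the constants `1` and `0`, array `0` holds
the adjacency matrix of `G`, and array `5` the offsets of its rows. -/
structure IsPrepared {n : ℕ} (G : SimpleGraph (Fin n)) (s : RamState) : Prop where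
  size : s.reg 0 = n
  one : s.reg 2 = 1
  zero : s.reg 3 = 0
  adj : ∀ u v : Fin n, s.arr 0 (u * n + v) ≠ 0 ↔ G.Adj u v
  row : ∀ u < n, s.arr 5 u = u * n

/-- The program does not write the memory that `IsPrepared` talks about. -/
def RamProgram.keepsInput (p : RamProgram) : Bool :=
  !(p.writesReg 0 || p.writesReg 2 || p.writesReg 3 || p.writesArr 0 || p.writesArr 5)

theorem IsPrepared.of_sameOff {n : ℕ} {G : SimpleGraph (Fin n)} {p : RamProgram} {s s' : RamState}
    (h : IsPrepared G s) (hs : SameOff p s s') (hp : p.keepsInput = true) : IsPrepared G s' := by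
  simp only [RamProgram.keepsInput, Bool.not_eq_true', Bool.or_eq_false_iff] at hp
  obtain ⟨⟨⟨⟨h0, h2⟩, h3⟩, ha⟩, hb⟩ := hp
  exact ⟨(hs.reg 0 h0).trans h.size, (hs.reg 2 h2).trans h.one, (hs.reg 3 h3).trans h.zero,
    by rw [hs.arr 0 ha]; exact h.adj, by rw [hs.arr 5 hb]; exact h.row⟩

/-- The set of vertices whose entries in the array `a` are nonzero. -/
def arraySet (n : ℕ) (a : ℕ → ℕ) : Finset (Fin n) :=
  Finset.univ.filter fun v => a v ≠ 0

theorem mem_arraySet {n : ℕ} {a : ℕ → ℕ} {v : Fin n} : v ∈ arraySet n a ↔ a v ≠ 0 := by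
  simp [arraySet]

/-- `reg d := A₀[reg u * n + reg v]` -/
def adjProg (d u v : ℕ) : RamProgram :=
  .seq (.load d 5 u) (.seq (.add d d v) (.load d 0 d))

/-- Array `2` becomes `expandSet` of arrays `1` and `2`. -/
def expandProg : RamProgram :=
  .seq
    (fillLoop 3 10 0 14
      (.seq (anyLoop 14 11 0 13
          (.seq (.load 12 2 11) (.branch 12 (adjProg 13 11 10) (.const 13 0))))
        (.seq (.load 12 1 10) (.seq (.branch 12 (.const 12 0) (.const 14 0))
          (.seq (.load 12 2 10) (.add 14 14 12))))))
    (fillLoop 2 10 0 14 (.load 14 3 10))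

/-- Repeat `expandProg` `reg b` times. -/
def reachProg (b : ℕ) : RamProgram := forDown 15 b expandProg

/-- Array `2` becomes the set of vertices reached in array `1` from the vertex `reg 16`. -/
def componentProg : RamProgram :=
  .seq (fillLoop 2 10 0 14 (.const 14 0)) (.seq (.store 2 16 2) (reachProg 0))

/-- `reg 13 ≠ 0` iff the vertex `reg 10` is not protected in array `1`. -/
def unprotectedProg : RamProgram :=
  .seq (.const 17 1) (.seq (.const 18 0) (.seq
    (forDown 11 0 (.seq (adjProg 12 10 11) (.seq (.load 13 1 11)
      (.branch 12 (.branch 13 (.add 17 17 2) (.add 18 18 2)) (.const 12 0)))))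
    (.sub 13 18 17)))

/-- `reg 14 ≠ 0` iff the vertex `reg 10` of array `1` is not protected or not in array `2`. -/
def badProg : RamProgram :=
  .seq unprotectedProg (.seq (.load 12 2 10) (.seq (.branch 12 (.const 12 0) (.const 13 1))
    (.seq (.load 12 1 10) (.branch 12 (.add 14 13 3) (.const 14 0)))))

/-- One pass that removes bad vertices from array `1`. -/
def peelPass : RamProgram :=
  .seq componentProg (forDown 10 0 (.seq badProg (.branch 14 (.store 1 10 3) (.const 14 0))))

/-- Array `1` becomes the largest connected defensive alliance in it that contains the vertex
`reg 16`, or loses that vertex if there is none. -/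
def peelProg : RamProgram := forDown 19 0 peelPass

/-- `reg 22 ≠ 0` iff array `1` is not a connected defensive alliance. -/
def testProg : RamProgram :=
  .seq (.const 21 0) (.seq (.const 16 0) (.seq
    (forDown 10 0 (.seq (.load 12 1 10)
      (.branch 12 (.seq (.const 21 1) (.add 16 10 3)) (.const 12 0))))
    (.seq componentProg (.seq (anyLoop 22 10 0 14 badProg)
      (.branch 21 (.const 12 0) (.const 22 1))))))

/-- One pass that removes vertices from array `1` as long as it stays a connected defensive
alliance. -/
def shrinkPass : RamProgram :=
  forDown 23 0 (.seq (.load 12 1 23) (.branch 12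
    (.seq (.store 1 23 3) (.seq testProg (.branch 22 (.store 1 23 2) (.const 12 0))))
    (.const 12 0)))

/-- Shrink array `1` to a locally minimal connected defensive alliance. -/
def shrinkProg : RamProgram := forDown 24 0 shrinkPass

/-- `reg 25` becomes the number of elements of array `1`. -/
def countProg : RamProgram :=
  .seq (.const 25 0) (forDown 10 0 (.seq (.load 12 1 10)
    (.branch 12 (.add 25 25 2) (.const 12 0))))

/-! ### Correctness and running times of the subroutines. -/

section

variable {n : ℕ} {G : SimpleGraph (Fin n)} {s : RamState}

/-- The result is collected in array `3` and copied afterwards, so array `2` keeps its old content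
during the search for neighbours. -/
theorem runs_expandProg (h : IsPrepared G s) :
    Runs expandProg s (50 * (n + 1) ^ 2) fun s' =>
      arraySet n (s'.arr 2) = expandSet G (arraySet n (s.arr 1)) (arraySet n (s.arr 2)) := by
  refine ((Runs.fillLoop (N := n) (T := (n + 1) * 14 + 8)
    (P := fun v => ∃ hv : v < n, ⟨v, hv⟩ ∈ expandSet G (arraySet n (s.arr 1)) (arraySet n (s.arr 2)))
    h.one h.zero h.size rfl (by decide) fun v hv s1 hs1 hv1 => ?_).seq
    (T' := (n + 1) * 4)
    (Q := fun s' => arraySet n (s'.arr 2) =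
      expandSet G (arraySet n (s.arr 1)) (arraySet n (s.arr 2)))
    fun s2 hs2 hP => ?_).mono ?_ fun _ _ h => h
  · have h1 := h.of_sameOff hs1 rfl
    refine ((Runs.anyLoop (T := 8) (P := fun u => ∃ hu : u < n, s.arr 2 u ≠ 0 ∧
        G.Adj ⟨u, hu⟩ ⟨v, hv⟩) (Q := fun u => ∃ hu : u < n, s.arr 2 u ≠ 0 ∧
        G.Adj ⟨u, hu⟩ ⟨v, hv⟩)
      h1.one h1.zero h1.size rfl rfl fun u hu s2 hs2 hu2 => Runs.of_eval rfl (by decide) ?_).seq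
      fun s2 hs2 hP => Runs.of_eval (T := 7) rfl (by decide) ?_).mono (by omega) fun _ _ h => h
    · have h2 := h1.of_sameOff hs2 rfl
      have e10 : s2.reg 10 = v := (hs2.reg 10 rfl).trans hv1
      have e2 : s2.arr 2 = s.arr 2 := (hs2.arr 2 rfl).trans (hs1.arr 2 rfl)
      have := h2.adj ⟨u, hu⟩ ⟨v, hv⟩
      by_cases h0 : s.arr 2 u = 0
      · simp [RamProgram.eval, RamState.setReg, hu2, e2, h0]
      · simpa [RamProgram.eval, adjProg, RamState.setReg, hu2, e2, h0, e10, h2.row u hu, hu]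
          using And.intro this.2 this.1
    · have e10 : s2.reg 10 = v := (hs2.reg 10 rfl).trans hv1
      have e1 : s2.arr 1 = s.arr 1 := (hs2.arr 1 rfl).trans (hs1.arr 1 rfl)
      have e2 : s2.arr 2 = s.arr 2 := (hs2.arr 2 rfl).trans (hs1.arr 2 rfl)
      have key : (∃ u : Fin n, ¬ s.arr 2 u = 0 ∧ G.Adj u ⟨v, hv⟩) ↔ ¬ s2.reg 14 = 0 := by
        constructor
        · rintro ⟨u, hu, hadj⟩
          exact hP.1 ⟨u, u.2, u.2, hu, hadj⟩
        · intro h0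
          obtain ⟨-, u, -, hu, hu0, hadj⟩ := hP.2 h0
          exact ⟨⟨u, hu⟩, hu0, hadj⟩
      by_cases h0 : s.arr 1 v = 0
      · simp [RamProgram.eval, RamState.setReg, e10, e1, e2, h0, hv, mem_expandSet, mem_arraySet]
      · simp [RamProgram.eval, RamState.setReg, e10, e1, e2, h0, hv, mem_expandSet, mem_arraySet,
          key]
        tauto
  · have h1 := h.of_sameOff hs2 rfl
    refine (Runs.fillLoop (N := n) (T := 1) (P := fun v => s2.arr 3 v ≠ 0) h1.one h1.zero h1.size
      rfl (by decide) fun v hv s3 hs3 hv3 => Runs.of_eval rfl (by decide) ?_).mono le_rfl ?_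
    · simp [RamProgram.eval, RamState.setReg, hv3, hs3.arr 3 rfl]
    · intro s3 _ hs3
      ext v
      rw [mem_arraySet, hs3 v v.2, hP v v.2]
      simp
  · have : (n + 1) * ((n + 1) * 14 + 8 + 3) + (n + 1) * 4 = 14 * (n + 1) ^ 2 + 15 * (n + 1) := by
      ring
    nlinarith

theorem runs_reachProg {b m : ℕ} (h : IsPrepared G s) (hb : s.reg b = m) :
    Runs (reachProg b) s ((m + 1) * (52 * (n + 1) ^ 2)) fun s' =>
      arraySet n (s'.arr 2) = reachSet G (arraySet n (s.arr 1)) (arraySet n (s.arr 2)) m := by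
  refine (Runs.forDown (N := m) (T := 50 * (n + 1) ^ 2) (fun j s' => j ≤ m ∧ arraySet n (s'.arr 2) =
    reachSet G (arraySet n (s.arr 1)) (arraySet n (s.arr 2)) (m - j)) h.one h.zero hb rfl rfl
    (by decide) (fun _ _ _ h => h) ⟨le_rfl, by simp [reachSet]⟩ fun j hj s1 hs1 hj1 hI => ?_).mono
    ?_ fun s' _ h => by simpa using h
  · have h1 : IsPrepared G s1 := h.of_sameOff (p := reachProg 0) (hs1.mono (fun _ h => h)
      (fun _ h => h)) rfl
    refine (runs_expandProg h1).mono le_rfl fun s2 hs2 he => ⟨hj.le, ?_⟩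
    rw [he, hI.2, hs1.arr 1 rfl, ← reachSet_succ]
    congr 1
    omega
  · gcongr
    nlinarith [Nat.one_le_pow 2 (n + 1) (by omega)]

theorem runs_componentProg (h : IsPrepared G s) {r : ℕ} (hr : r < n) (hs : s.reg 16 = r) :
    Runs componentProg s (57 * (n + 1) ^ 3) fun s' =>
      arraySet n (s'.arr 2) = reachSet G (arraySet n (s.arr 1)) {⟨r, hr⟩} n := by
  refine ((Runs.fillLoop (N := n) (T := 1) (P := fun _ => False) h.one h.zero h.size rfl (by decide)
    fun v hv s1 hs1 hv1 => Runs.of_eval rfl (by decide) ?_).seq fun s1 hs1 h0 =>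
    (Runs.of_eval (T := 1) (Q := fun s' => arraySet n (s'.arr 2) = {⟨r, hr⟩}) rfl (by decide)
      ?_).seq fun s2 hs2 h02 => (runs_reachProg ((h.of_sameOff hs1 rfl).of_sameOff hs2 rfl)
        (((h.of_sameOff hs1 rfl).of_sameOff hs2 rfl).size)).mono le_rfl fun s3 _ h3 => ?_).mono
    ?_ fun _ _ h => h
  · simp [RamProgram.eval, RamState.setReg]
  · ext v
    have := h0 v v.2
    have h1 := h.of_sameOff hs1 rfl
    have e16 : s1.reg 16 = r := (hs1.reg 16 rfl).trans hs
    rw [mem_arraySet]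
    by_cases hv : (v : ℕ) = r
    · simp [RamProgram.eval, RamState.setArr, e16, hv, h1.one, Fin.ext_iff]
    · simp only [RamProgram.eval, RamState.setArr, e16, h1.one, Function.update_self,
        Function.update_of_ne hv]
      simpa [Fin.ext_iff, hv] using this
  · rw [h3, h02, hs2.arr 1 rfl, hs1.arr 1 rfl]
  · have : (n + 1) * (1 + 3) + (1 + (n + 1) * (52 * (n + 1) ^ 2)) = 52 * (n + 1) ^ 3 + 4 * (n + 1) + 1 := by
      ring
    rw [this]
    nlinarith [Nat.one_le_pow 3 (n + 1) (by omega), Nat.le_self_pow (n := 3) (by omega) (n + 1)]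

theorem card_filter_le_step (A : Finset (Fin n)) {u : ℕ} (hu : u < n) :
    (A.filter fun x : Fin n => u ≤ (x : ℕ)).card =
      (A.filter fun x : Fin n => u + 1 ≤ (x : ℕ)).card + if ⟨u, hu⟩ ∈ A then 1 else 0 := by
  split_ifs with hA
  · rw [← Finset.card_insert_of_notMem (a := (⟨u, hu⟩ : Fin n)) (by simp)]
    congr 1
    ext x
    simp only [Finset.mem_filter, Finset.mem_insert, Fin.ext_iff]
    constructor
    · rintro ⟨hx, hux⟩
      exact hux.eq_or_lt.imp Eq.symm fun h => ⟨hx, h⟩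
    · rintro (hx | ⟨hx, hux⟩)
      · obtain rfl : x = ⟨u, hu⟩ := Fin.ext hx
        exact ⟨hA, le_rfl⟩
      · exact ⟨hx, by omega⟩
  · rw [Nat.add_zero]
    congr 1
    refine Finset.filter_congr fun x hx => ⟨fun h => ?_, fun h => by omega⟩
    refine Nat.lt_of_le_of_ne h fun he => hA ?_
    obtain rfl : x = ⟨u, hu⟩ := Fin.ext he.symm
    exact hx

/-- Registers `17` and `18` count the two sides of the protection inequality; register `17` starts
at 1 because `v` itself counts when it lies in the set. The truncated difference is nonzero exactly
when protection fails. -/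
theorem runs_unprotectedProg (h : IsPrepared G s) [DecidableRel G.Adj] {v : ℕ} (hv : v < n)
    (hs : s.reg 10 = v) :
    Runs unprotectedProg s (20 * (n + 1)) fun s' => ⟨v, hv⟩ ∈ arraySet n (s.arr 1) →
      (s'.reg 13 ≠ 0 ↔ ¬ IsProtected G (arraySet n (s.arr 1)) ⟨v, hv⟩) := by
  set D := arraySet n (s.arr 1) with hD
  set w : Fin n := ⟨v, hv⟩
  refine ((Runs.of_eval (T := 1) (Q := fun s' => s'.reg 17 = 1) rfl (by decide) ?_).seq
    fun s1 hs1 h17 => (Runs.of_eval (T := 1) (Q := fun s' => s'.reg 18 = 0) rfl (by decide) ?_).seq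
    fun s2 hs2 h18 => (Runs.forDown (N := n) (T := 11) (fun j s' =>
      s'.reg 17 = ((G.neighborFinset w ∩ D).filter fun u : Fin n => j ≤ (u : ℕ)).card + 1 ∧
      s'.reg 18 = ((G.neighborFinset w \ D).filter fun u : Fin n => j ≤ (u : ℕ)).card) ?_ ?_ ?_ rfl rfl (by decide)
      ?_ ?_ fun u hu s3 hs3 hu3 hI => Runs.of_eval rfl (by decide) ?_).seq fun s3 hs3 hI =>
    Runs.of_eval (T := 1) rfl (by decide) ?_).mono ?_ fun _ _ h => h
  · simp [RamProgram.eval, RamState.setReg]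
  · simp [RamProgram.eval, RamState.setReg]
  · exact ((h.of_sameOff hs1 rfl).of_sameOff hs2 rfl).one
  · exact ((h.of_sameOff hs1 rfl).of_sameOff hs2 rfl).zero
  · exact ((h.of_sameOff hs1 rfl).of_sameOff hs2 rfl).size
  · intro j s a h
    simpa [RamState.setReg] using h
  · have (A : Finset (Fin n)) : (A.filter fun u : Fin n => n ≤ (u : ℕ)) = ∅ :=
      Finset.filter_eq_empty_iff.2 fun u _ => by omega
    rw [hs2.reg 17 rfl, h17, h18, this, this]
    simp
  · have h3 := ((h.of_sameOff hs1 rfl).of_sameOff hs2 rfl).of_sameOff hs3 rfl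
    have e10 : s3.reg 10 = v := by rw [hs3.reg 10 rfl, hs2.reg 10 rfl, hs1.reg 10 rfl, hs]
    have e1 : s3.arr 1 = s.arr 1 := by rw [hs3.arr 1 rfl, hs2.arr 1 rfl, hs1.arr 1 rfl]
    have hadj : G.Adj w ⟨u, hu⟩ ↔ s3.arr 0 (v * n + u) ≠ 0 := (h3.adj w ⟨u, hu⟩).symm
    have hu1 : ⟨u, hu⟩ ∈ D ↔ s.arr 1 u ≠ 0 := mem_arraySet
    rw [card_filter_le_step _ hu, card_filter_le_step _ hu]
    simp only [Finset.mem_inter, Finset.mem_sdiff, SimpleGraph.mem_neighborFinset, hu1, hadj]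
    by_cases ha : s3.arr 0 (v * n + u) = 0
    · simp [RamProgram.eval, adjProg, RamState.setReg, e10, h3.row v hv, hu3, ha, hI]
    · by_cases hb : s.arr 1 u = 0
      · simp [RamProgram.eval, adjProg, RamState.setReg, e10, h3.row v hv, hu3, ha, hI, e1, hb, h3.one]
      · simp [RamProgram.eval, adjProg, RamState.setReg, e10, h3.row v hv, hu3, ha, hI, e1, hb, h3.one]
  · intro hw
    rw [isProtected_iff hw]
    simp [RamProgram.eval, RamState.setReg, hI]
    omega
  · omega

theorem runs_badProg (h : IsPrepared G s) [DecidableRel G.Adj] {v : ℕ} (hv : v < n)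
    (hs : s.reg 10 = v) :
    Runs badProg s (30 * (n + 1)) fun s' => s'.reg 14 ≠ 0 ↔ ⟨v, hv⟩ ∈ arraySet n (s.arr 1) ∧
      (⟨v, hv⟩ ∉ arraySet n (s.arr 2) ∨ ¬ IsProtected G (arraySet n (s.arr 1)) ⟨v, hv⟩) := by
  refine ((runs_unprotectedProg h hv hs).seq fun s1 hs1 hp => Runs.of_eval (T := 8) rfl (by decide)
    ?_).mono (by omega) fun _ _ h => h
  have h1 := h.of_sameOff hs1 rfl
  have e10 : s1.reg 10 = v := (hs1.reg 10 rfl).trans hs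
  have e1 : s1.arr 1 = s.arr 1 := hs1.arr 1 rfl
  have e2 : s1.arr 2 = s.arr 2 := hs1.arr 2 rfl
  simp only [mem_arraySet] at hp ⊢
  by_cases ha : s.arr 1 v = 0
  · by_cases hb : s.arr 2 v = 0 <;>
      simp [RamProgram.eval, RamState.setReg, e10, e1, e2, ha, hb]
  · rw [← hp ha]
    by_cases hb : s.arr 2 v = 0
    · simp [RamProgram.eval, RamState.setReg, e10, e1, e2, ha, hb]
    · simp [RamProgram.eval, RamState.setReg, e10, e1, e2, ha, hb, h1.zero]

theorem arraySet_update_zero {a : ℕ → ℕ} {v : ℕ} (hv : v < n) :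
    arraySet n (Function.update a v 0) = (arraySet n a).erase ⟨v, hv⟩ := by
  ext u
  by_cases hu : (u : ℕ) = v <;> simp [mem_arraySet, hu, Fin.ext_iff]

theorem arraySet_update_one {a : ℕ → ℕ} {v : ℕ} (hv : v < n) :
    arraySet n (Function.update a v 1) = insert ⟨v, hv⟩ (arraySet n a) := by
  ext u
  by_cases hu : (u : ℕ) = v <;> simp [mem_arraySet, hu, Fin.ext_iff]

/-- Monotonicity is what makes peeling safe: a vertex protected in a smaller alliance is protected
in every larger set. -/
theorem IsProtected.mono [DecidableRel G.Adj] {C D : Finset (Fin n)} {v : Fin n}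
    (h : IsProtected G C v) (hCD : C ⊆ D) : IsProtected G D v := by
  refine (Finset.card_le_card ?_).trans (Nat.le_trans h (Finset.card_le_card ?_))
  · exact Finset.sdiff_subset_sdiff subset_rfl hCD
  · exact Finset.inter_subset_inter subset_rfl hCD

/-- The component of `r` is computed once per pass, while protection is tested in the current set.
No vertex of a connected defensive alliance through `r` is lost, and a pass that removes nothing has
verified every vertex. -/
theorem runs_peelPass (h : IsPrepared G s) [DecidableRel G.Adj] {r : ℕ} (hr : r < n)
    (hs : s.reg 16 = r) :
    Runs peelPass s (100 * (n + 1) ^ 3) fun s' =>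
      arraySet n (s'.arr 1) ⊆ arraySet n (s.arr 1) ∧
      (∀ C, IsConnectedDefensiveAlliance G C → ⟨r, hr⟩ ∈ C → C ⊆ arraySet n (s.arr 1) →
        C ⊆ arraySet n (s'.arr 1)) ∧
      (arraySet n (s'.arr 1) = arraySet n (s.arr 1) → ⟨r, hr⟩ ∈ arraySet n (s.arr 1) →
        IsConnectedDefensiveAlliance G (arraySet n (s.arr 1))) := by
  set D := arraySet n (s.arr 1) with hD
  refine ((runs_componentProg h hr hs).seq fun s1 hs1 hX => (Runs.forDown (N := n)
    (T := 30 * (n + 1) + 3) (fun j s' => arraySet n (s'.arr 1) ⊆ D ∧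
      (∀ C, IsConnectedDefensiveAlliance G C → (⟨r, hr⟩ : Fin n) ∈ C → C ⊆ D → C ⊆ arraySet n (s'.arr 1)) ∧
      (arraySet n (s'.arr 1) = D → ∀ v : Fin n, j ≤ v → v ∈ D →
        v ∈ reachSet G D {(⟨r, hr⟩ : Fin n)} n ∧ IsProtected G D v))
    (h.of_sameOff hs1 rfl).one (h.of_sameOff hs1 rfl).zero (h.of_sameOff hs1 rfl).size rfl rfl
    (by decide) (fun _ _ _ h => h) ?_ fun v hv s2 hs2 hv2 ⟨hI1, hI2, hI3⟩ => ?_).mono le_rfl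
    fun s' _ ⟨h1, h2, h3⟩ => ⟨h1, h2, fun he hrD => ?_⟩).mono ?_ fun _ _ h => h
  · refine ⟨by rw [hs1.arr 1 rfl], fun C _ _ hC => by rwa [hs1.arr 1 rfl], ?_⟩
    intro _ v hv
    omega
  · have h2 := (h.of_sameOff hs1 rfl).of_sameOff hs2 rfl
    rw [← hs2.arr 2 rfl] at hX
    refine (runs_badProg h2 hv hv2).seq fun s3 hs3 hbad => Runs.of_eval rfl le_rfl ?_
    have e10 : s3.reg 10 = v := (hs3.reg 10 rfl).trans hv2
    have e3 := (h2.of_sameOff hs3 rfl).zero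
    have e1 : s3.arr 1 = s2.arr 1 := hs3.arr 1 rfl
    rw [hX, ← hD] at hbad
    by_cases h14 : s3.reg 14 = 0
    · simp only [RamProgram.eval, h14, if_true, RamState.setReg, e1]
      refine ⟨hI1, hI2, fun he u hu huD => ?_⟩
      rcases hu.eq_or_lt with hu | hu
      · obtain rfl : u = ⟨v, hv⟩ := Fin.ext hu.symm
        have := (not_congr hbad).1 (by simpa using h14)
        rw [he] at this
        tauto
      · exact hI3 he u hu huD
    · obtain ⟨hvD, hbad⟩ := hbad.1 h14
      simp only [RamProgram.eval, h14, if_false, RamState.setArr, e1, e3, e10,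
        Function.update_self, arraySet_update_zero hv]
      refine ⟨(Finset.erase_subset _ _).trans hI1, fun C hC hrC hCD => ?_, fun he => ?_⟩
      · have hCs := hI2 C hC hrC hCD
        refine Finset.subset_erase.2 ⟨hCs, fun hvC => ?_⟩
        obtain ⟨hCc, hCp⟩ := isConnectedDefensiveAlliance_iff.1 hC
        rcases hbad with hb | hb
        · refine hb (reachSet_mono G hCD subset_rfl le_rfl (hCc.subset_reachSet hrC ?_ hvC))
          exact C.card_le_univ.trans (by simp)
        · exact hb ((hCp _ hvC).mono hCs)
      · have := he.symm.subset (hI1 hvD)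
        simp at this
  · have : (n + 1) * (30 * (n + 1) + 3 + 2) = 30 * (n + 1) ^ 2 + 5 * (n + 1) := by ring
    have := Nat.pow_le_pow_right (n := n + 1) (by omega) (show 2 ≤ 3 by omega)
    have := Nat.le_self_pow (n := 3) (by omega) (n + 1)
    omega
  · rw [isConnectedDefensiveAlliance_iff]
    exact ⟨isConnectedSet_of_subset_reachSet hrD fun v hv => (h3 he v (Nat.zero_le _) hv).1,
      fun v hv => (h3 he v (Nat.zero_le _) hv).2⟩

/-- Each of the `n` passes lowers the cardinality unless a fixed point is reached. An alliance
containing `r` is itself preserved by later passes. -/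
theorem runs_peelProg (h : IsPrepared G s) [DecidableRel G.Adj] {r : ℕ} (hr : r < n)
    (hs : s.reg 16 = r) :
    Runs peelProg s (102 * (n + 1) ^ 4) fun s' =>
      arraySet n (s'.arr 1) ⊆ arraySet n (s.arr 1) ∧
      (∀ C, IsConnectedDefensiveAlliance G C → ⟨r, hr⟩ ∈ C → C ⊆ arraySet n (s.arr 1) →
        C ⊆ arraySet n (s'.arr 1)) ∧
      (⟨r, hr⟩ ∈ arraySet n (s'.arr 1) → IsConnectedDefensiveAlliance G (arraySet n (s'.arr 1))) := by
  set D := arraySet n (s.arr 1) with hD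
  refine (Runs.forDown (N := n) (T := 100 * (n + 1) ^ 3) (fun j s' => arraySet n (s'.arr 1) ⊆ D ∧
      (∀ C, IsConnectedDefensiveAlliance G C → (⟨r, hr⟩ : Fin n) ∈ C → C ⊆ D → C ⊆ arraySet n (s'.arr 1)) ∧
      (((⟨r, hr⟩ : Fin n) ∈ arraySet n (s'.arr 1) →
        IsConnectedDefensiveAlliance G (arraySet n (s'.arr 1))) ∨ (arraySet n (s'.arr 1)).card ≤ j))
    h.one h.zero h.size rfl rfl
    (by decide) (fun _ _ _ h => h) ?_ fun j hj s2 hs2 hj2 ⟨hI1, hI2, hI3⟩ => ?_).mono ?_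
    fun s' _ ⟨h1, h2, h3⟩ => ⟨h1, h2, fun hrD => ?_⟩
  · exact ⟨subset_rfl, fun C _ _ hC => hC, .inr ((Finset.card_le_univ _).trans (by simp))⟩
  · have h2 := h.of_sameOff (p := peelProg) hs2 rfl
    refine (runs_peelPass h2 hr ((hs2.reg 16 rfl).trans hs)).mono le_rfl
      fun s3 hs3 ⟨hP1, hP2, hP3⟩ => ⟨hP1.trans hI1, fun C hC hrC hCD =>
        hP2 C hC hrC (hI2 C hC hrC hCD), ?_⟩
    by_cases he : arraySet n (s3.arr 1) = arraySet n (s2.arr 1)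
    · left
      intro hrD
      rw [he] at hrD ⊢
      exact hP3 he hrD
    · rcases hI3 with hI3 | hI3
      · left
        intro hrD
        exact (he (hP1.antisymm (hP2 _ (hI3 (hP1 hrD)) (hP1 hrD) subset_rfl))).elim
      · right
        exact Nat.le_of_lt_succ ((Finset.card_lt_card (hP1.ssubset_of_ne he)).trans_le hI3)
  · have : (n + 1) * (100 * (n + 1) ^ 3 + 2) = 100 * (n + 1) ^ 4 + 2 * (n + 1) := by ring
    have := Nat.le_self_pow (n := 4) (by omega) (n + 1)
    omega
  · refine h3.elim (fun h => h hrD) fun h => ?_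
    rw [Nat.le_zero, Finset.card_eq_zero] at h
    simp [h] at hrD

theorem runs_testProg (h : IsPrepared G s) [DecidableRel G.Adj] (hn : 0 < n) :
    Runs testProg s (150 * (n + 1) ^ 3) fun s' =>
      s'.reg 22 ≠ 0 ↔ ¬ IsConnectedDefensiveAlliance G (arraySet n (s.arr 1)) := by
  set D := arraySet n (s.arr 1) with hD
  refine ((Runs.of_eval (T := 1) (Q := fun s' => s'.reg 21 = 0) rfl (by decide) ?_).seq
    fun s1 hs1 h21 => (Runs.of_eval (T := 1) (Q := fun s' => s'.reg 16 = 0) rfl (by decide) ?_).seq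
    fun s2 hs2 h16 => (Runs.forDown (N := n) (T := 5) (fun j s' =>
      (s'.reg 21 = 0 → s'.reg 16 = 0 ∧ ∀ v ∈ D, (v : ℕ) < j) ∧
      (s'.reg 21 ≠ 0 → ∃ hr : s'.reg 16 < n, ⟨_, hr⟩ ∈ D)) ?_ ?_ ?_ rfl rfl (by decide)
      ?_ ?_ fun v hv s3 hs3 hv3 hI => Runs.of_eval rfl (by decide) ?_).seq fun s3 hs3 hI =>
    (?_ : Runs _ _ (57 * (n + 1) ^ 3 + ((n + 1) * (30 * (n + 1) + 6) + 4)) _)).mono ?_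
    fun _ _ h => h
  · simp [RamProgram.eval, RamState.setReg]
  · simp [RamProgram.eval, RamState.setReg]
  · exact ((h.of_sameOff hs1 rfl).of_sameOff hs2 rfl).one
  · exact ((h.of_sameOff hs1 rfl).of_sameOff hs2 rfl).zero
  · exact ((h.of_sameOff hs1 rfl).of_sameOff hs2 rfl).size
  · intro j s a h
    simpa [RamState.setReg] using h
  · rw [hs2.reg 21 rfl, h21, h16]
    simp
  · have e1 : s3.arr 1 = s.arr 1 := by rw [hs3.arr 1 rfl, hs2.arr 1 rfl, hs1.arr 1 rfl]
    have e3 := ((h.of_sameOff hs1 rfl).of_sameOff hs2 rfl).of_sameOff hs3 rfl |>.zero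
    by_cases hvD : s.arr 1 v = 0
    · simp only [RamProgram.eval, RamState.setReg, Function.update_self, hv3, e1, hvD, if_true,
        ne_eq, not_false_eq_true, Function.update_of_ne,
        Nat.reduceEqDiff]
      refine ⟨fun h0 => ⟨(hI.1 h0).1, fun u hu => ?_⟩, hI.2⟩
      refine Nat.lt_of_le_of_ne (Nat.le_of_lt_succ ((hI.1 h0).2 u hu)) fun he => ?_
      exact mem_arraySet.1 hu (he ▸ hvD)
    · simp [RamProgram.eval, RamState.setReg, hv3, e1, e3, hvD, hv, hD, mem_arraySet]
  · have h3 := ((h.of_sameOff hs1 rfl).of_sameOff hs2 rfl).of_sameOff hs3 rfl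
    have e1 : s3.arr 1 = s.arr 1 := by rw [hs3.arr 1 rfl, hs2.arr 1 rfl, hs1.arr 1 rfl]
    -- For an empty set the root defaults to vertex `0`, a valid index since `0 < n`. The flag in
    -- register `21` then overrides the outcome.
    have hr : s3.reg 16 < n := by
      by_cases h0 : s3.reg 21 = 0
      · rw [(hI.1 h0).1]
        exact hn
      · exact (hI.2 h0).1
    refine (runs_componentProg h3 hr rfl).seq fun s4 hs4 hX =>
      (Runs.anyLoop (N := n) (T := 30 * (n + 1))
      (P := fun v => ∃ hv : v < n, ⟨v, hv⟩ ∈ D ∧ (⟨v, hv⟩ ∉ reachSet G D {⟨_, hr⟩} n ∨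
        ¬ IsProtected G D ⟨v, hv⟩))
      (Q := fun v => ∃ hv : v < n, ⟨v, hv⟩ ∈ D ∧ (⟨v, hv⟩ ∉ reachSet G D {⟨_, hr⟩} n ∨
        ¬ IsProtected G D ⟨v, hv⟩))
      (h3.of_sameOff hs4 rfl).one (h3.of_sameOff hs4 rfl).zero (h3.of_sameOff hs4 rfl).size rfl rfl
      fun v hv s5 hs5 hv5 => ?_).seq fun s5 hs5 hB => Runs.of_eval rfl (by decide) ?_
    · refine (runs_badProg ((h3.of_sameOff hs4 rfl).of_sameOff hs5 rfl) hv hv5).mono le_rfl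
        fun s6 hs6 hbad => ?_
      rw [hs5.arr 1 rfl, hs5.arr 2 rfl, hX, hs4.arr 1 rfl, e1, ← hD] at hbad
      exact ⟨fun ⟨_, h⟩ => hbad.2 h, fun h => ⟨hv, hbad.1 h⟩⟩
    · have e21 : s5.reg 21 = s3.reg 21 := (hs5.reg 21 rfl).trans (hs4.reg 21 rfl)
      by_cases h0 : s3.reg 21 = 0
      · simp only [RamProgram.eval, e21, h0, if_true, RamState.setReg, Function.update_self]
        simp only [ne_eq, one_ne_zero, not_false_eq_true, true_iff]
        rintro ⟨⟨⟨v, hv⟩, -⟩, -⟩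
        exact absurd ((hI.1 h0).2 v hv) (Nat.not_lt_zero _)
      · simp only [RamProgram.eval, e21, h0, if_false, RamState.setReg]
        obtain ⟨hr', hrD⟩ := hI.2 h0
        rw [isConnectedDefensiveAlliance_iff, isConnectedSet_iff_subset_reachSet hrD,
          Fintype.card_fin, Function.update_of_ne (by decide)]
        constructor
        · intro h22 ⟨hc, hp⟩
          obtain ⟨-, v, -, hv, hvD, hb⟩ := hB.2 h22
          exact hb.elim (fun h => h (hc hvD)) fun h => h (hp _ hvD)
        · intro hnot
          refine hB.1 ?_
          by_contra! hcon
          exact hnot ⟨fun v hv => (hcon v v.2 v.2 hv).1, fun v hv => (hcon v v.2 v.2 hv).2⟩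
  · have : (n + 1) * (30 * (n + 1) + 6) = 30 * (n + 1) ^ 2 + 6 * (n + 1) := by ring
    have := Nat.pow_le_pow_right (n := n + 1) (by omega) (show 2 ≤ 3 by omega)
    have := Nat.le_self_pow (n := 3) (by omega) (n + 1)
    omega

/-- Sets only get smaller, so if the pass ends where it began, every test was made against the
original set. A removal may make an earlier vertex removable, hence the repeated passes in
`shrinkProg`. -/
theorem runs_shrinkPass (h : IsPrepared G s) [DecidableRel G.Adj] :
    Runs shrinkPass s (160 * (n + 1) ^ 4) fun s' =>
      ShrinksTo G (arraySet n (s.arr 1)) (arraySet n (s'.arr 1)) ∧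
      (arraySet n (s'.arr 1) = arraySet n (s.arr 1) → ∀ v ∈ arraySet n (s.arr 1),
        ¬ IsConnectedDefensiveAlliance G ((arraySet n (s.arr 1)).erase v)) := by
  set D := arraySet n (s.arr 1) with hD
  refine (Runs.forDown (N := n) (T := 150 * (n + 1) ^ 3 + 6) (fun j s' =>
      ShrinksTo G D (arraySet n (s'.arr 1)) ∧
      (arraySet n (s'.arr 1) = D → ∀ v : Fin n, j ≤ v → v ∈ D →
        ¬ IsConnectedDefensiveAlliance G (D.erase v)))
    h.one h.zero h.size rfl rfl
    (by decide) (fun _ _ _ h => h) ?_ fun v hv s2 hs2 hv2 ⟨hI1, hI2⟩ => ?_).mono ?_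
    fun s' _ ⟨h1, h2⟩ => ⟨h1, fun he v hv => h2 he v (Nat.zero_le _) hv⟩
  · exact ⟨.refl, fun _ v hv => by omega⟩
  · have h2 := h.of_sameOff (p := shrinkPass) hs2 rfl
    have hstep : (arraySet n (s2.arr 1) = D → ⟨v, hv⟩ ∈ D →
        ¬ IsConnectedDefensiveAlliance G (D.erase ⟨v, hv⟩)) →
        ShrinksTo G D (arraySet n (s2.arr 1)) ∧
      (arraySet n (s2.arr 1) = D → ∀ u : Fin n, v ≤ u → u ∈ D →
        ¬ IsConnectedDefensiveAlliance G (D.erase u)) := fun hv' =>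
      ⟨hI1, fun he u hu huD => by
        rcases hu.eq_or_lt with hu | hu
        · obtain rfl : u = ⟨v, hv⟩ := Fin.ext hu.symm
          exact hv' he huD
        · exact hI2 he u hu huD⟩
    refine ((Runs.of_eval (T := 1) (Q := fun s' => s'.reg 12 = s2.arr 1 v) rfl (by decide) ?_).seq
      fun s3 hs3 h12 => Runs.branch (T := 150 * (n + 1) ^ 3 + 4) (fun h0 => ?_) fun h0 => ?_).mono
      (by omega) fun _ _ h => h
    · simp [RamProgram.eval, RamState.setReg, hv2]
    · have h3 := h2.of_sameOff hs3 rfl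
      have e23 : s3.reg 23 = v := (hs3.reg 23 rfl).trans hv2
      have e1 : s3.arr 1 = s2.arr 1 := hs3.arr 1 rfl
      rw [h12] at h0
      have hvD : (⟨v, hv⟩ : Fin n) ∈ arraySet n (s2.arr 1) := mem_arraySet.2 h0
      refine ((Runs.of_eval (T := 1) (Q := fun s' => arraySet n (s'.arr 1) =
        (arraySet n (s2.arr 1)).erase ⟨v, hv⟩) rfl (by decide) ?_).seq fun s4 hs4 h4 =>
        (runs_testProg (h3.of_sameOff hs4 rfl) (by omega)).seq fun s5 hs5 hT =>
        Runs.of_eval (T := 3) rfl (by decide) ?_).mono (by omega) fun _ _ h => h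
      · simp only [RamProgram.eval, RamState.setArr, e23, e1, h3.zero, Function.update_self,
          arraySet_update_zero hv]
      · rw [h4] at hT
        have e5 : s5.arr 1 = s4.arr 1 := hs5.arr 1 rfl
        have e23' : s5.reg 23 = v := by rw [hs5.reg 23 rfl, hs4.reg 23 rfl, e23]
        by_cases h22 : s5.reg 22 = 0
        · simp only [RamProgram.eval, h22, if_true, RamState.setReg, e5, h4]
          have hc := not_not.1 ((not_congr hT).1 (not_not.2 h22))
          refine ⟨hI1.tail ⟨_, hvD, rfl, hc⟩, fun he => ?_⟩
          have := he.symm.subset (hI1.subset hvD)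
          simp at this
        · simp only [RamProgram.eval, h22, if_false, RamState.setArr, e5, e23',
            ((h3.of_sameOff hs4 rfl).of_sameOff hs5 rfl).one, Function.update_self,
            arraySet_update_one hv, h4, Finset.insert_erase hvD]
          exact hstep fun he _ => he ▸ hT.1 h22
    · refine Runs.of_eval (T := 1) rfl (by decide) ?_ |>.mono (by omega) fun _ _ h => h
      simp only [RamProgram.eval, RamState.setReg, hs3.arr 1 rfl]
      refine hstep fun he hvD => ?_
      rw [← he, mem_arraySet] at hvD
      exact (hvD (h12 ▸ h0)).elim
  · have : (n + 1) * (150 * (n + 1) ^ 3 + 6 + 2) = 150 * (n + 1) ^ 4 + 8 * (n + 1) := by ring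
    have := Nat.le_self_pow (n := 4) (by omega) (n + 1)
    omega

theorem runs_shrinkProg (h : IsPrepared G s) [DecidableRel G.Adj] :
    Runs shrinkProg s (162 * (n + 1) ^ 5) fun s' =>
      ShrinksTo G (arraySet n (s.arr 1)) (arraySet n (s'.arr 1)) ∧
      ∀ v ∈ arraySet n (s'.arr 1),
        ¬ IsConnectedDefensiveAlliance G ((arraySet n (s'.arr 1)).erase v) := by
  set D := arraySet n (s.arr 1) with hD
  refine (Runs.forDown (N := n) (T := 160 * (n + 1) ^ 4) (fun j s' =>
      ShrinksTo G D (arraySet n (s'.arr 1)) ∧ ((∀ v ∈ arraySet n (s'.arr 1),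
        ¬ IsConnectedDefensiveAlliance G ((arraySet n (s'.arr 1)).erase v)) ∨
      (arraySet n (s'.arr 1)).card ≤ j))
    h.one h.zero h.size rfl rfl
    (by decide) (fun _ _ _ h => h) ?_ fun j hj s2 hs2 hj2 ⟨hI1, hI2⟩ => ?_).mono ?_
    fun s' _ ⟨h1, h2⟩ => ⟨h1, fun v hv => ?_⟩
  · exact ⟨.refl, .inr ((Finset.card_le_univ _).trans (by simp))⟩
  · refine (runs_shrinkPass (h.of_sameOff (p := shrinkProg) hs2 rfl)).mono le_rfl
      fun s3 hs3 ⟨hP1, hP2⟩ => ⟨hI1.trans hP1, ?_⟩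
    by_cases he : arraySet n (s3.arr 1) = arraySet n (s2.arr 1)
    · rw [he]
      exact .inl (hP2 he)
    · rcases hI2 with hI2 | hI2
      · exact (he (hP1.eq_of_minimal hI2)).elim
      · right
        exact Nat.le_of_lt_succ ((Finset.card_lt_card (hP1.subset.ssubset_of_ne he)).trans_le hI2)
  · have : (n + 1) * (160 * (n + 1) ^ 4 + 2) = 160 * (n + 1) ^ 5 + 2 * (n + 1) := by ring
    have := Nat.le_self_pow (n := 5) (by omega) (n + 1)
    omega
  · refine h2.elim (fun h => h v hv) fun h => ?_
    rw [Nat.le_zero, Finset.card_eq_zero] at h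
    simp [h] at hv

theorem runs_countProg (h : IsPrepared G s) :
    Runs countProg s (10 * (n + 1)) fun s' => s'.reg 25 = (arraySet n (s.arr 1)).card := by
  set D := arraySet n (s.arr 1) with hD
  refine ((Runs.of_eval (T := 1) (Q := fun s' => s'.reg 25 = 0) rfl (by decide) ?_).seq
    fun s1 hs1 h25 => (Runs.forDown (N := n) (T := 4) (fun j s' =>
      s'.reg 25 = (D.filter fun u : Fin n => j ≤ (u : ℕ)).card) (h.of_sameOff hs1 rfl).one
      (h.of_sameOff hs1 rfl).zero (h.of_sameOff hs1 rfl).size rfl rfl (by decide) ?_ ?_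
      fun v hv s2 hs2 hv2 hI => Runs.of_eval rfl (by decide) ?_).mono le_rfl fun s2 _ h2 => ?_).mono
    (by omega) fun _ _ h => h
  · simp [RamProgram.eval, RamState.setReg]
  · intro j s a h
    simpa [RamState.setReg] using h
  · rw [h25, Finset.filter_eq_empty_iff.2 fun u _ => by omega, Finset.card_empty]
  · have e1 : s2.arr 1 = s.arr 1 := (hs2.arr 1 rfl).trans (hs1.arr 1 rfl)
    have e2 := ((h.of_sameOff hs1 rfl).of_sameOff hs2 rfl).one
    have hm : (⟨v, hv⟩ : Fin n) ∈ D ↔ s.arr 1 v ≠ 0 := mem_arraySet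
    rw [card_filter_le_step D hv]
    by_cases hvD : s.arr 1 v = 0
    · simp [RamProgram.eval, RamState.setReg, hv2, e1, hvD, hI, hm]
    · simp [RamProgram.eval, RamState.setReg, hv2, e1, hvD, hI, e2, hm]
  · simpa using h2

end

/-! ### The algorithm -/

/-- `weight b i` is two to the number of nonzero entries `b v` with `v < i`. -/
def weight (b : ℕ → ℕ) : ℕ → ℕ
  | 0 => 1
  | i + 1 => if b i = 0 then weight b i else weight b i + weight b i

/-- The number that encodes `{v ∈ F | v < i}`, a set of nonzero entries of `b`. -/
def setCode {n : ℕ} (b : ℕ → ℕ) (F : Finset (Fin n)) : ℕ → ℕ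
  | 0 => 0
  | i + 1 => if i ∈ F.map Fin.valEmbedding then setCode b F i + weight b i else setCode b F i

/-- The lower digits together stay below the next weight. Comparing the remaining code with the
weight therefore reveals the top digit, and the codes below `weight b n` cover all subsets. -/
theorem setCode_lt_weight {n : ℕ} {b : ℕ → ℕ} {F : Finset (Fin n)} (hF : F ⊆ arraySet n b) (i : ℕ) :
    setCode b F i < weight b i := by
  induction i with
  | zero => simp [setCode, weight]
  | succ i ih =>
    rw [setCode, weight]
    by_cases hi : i ∈ F.map Fin.valEmbedding
    · have hb : b i ≠ 0 := by
        obtain ⟨v, hv, rfl⟩ := Finset.mem_map.1 hi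
        exact mem_arraySet.1 (hF hv)
      rw [if_pos hi, if_neg hb]
      omega
    · rw [if_neg hi]
      split_ifs <;> omega

theorem weight_eq {n : ℕ} (b : ℕ → ℕ) {i : ℕ} (hi : i ≤ n) :
    weight b i = 2 ^ ((arraySet n b).filter fun v : Fin n => (v : ℕ) < i).card := by
  induction i with
  | zero => simp [weight]
  | succ i ih =>
    have hin : i < n := hi
    rw [weight, ih (by omega)]
    split_ifs with hb
    · congr 2
      refine Finset.filter_congr fun v hv => ⟨fun h => by omega, fun h => ?_⟩
      refine Nat.lt_of_le_of_ne (Nat.le_of_lt_succ h) fun he => ?_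
      exact mem_arraySet.1 hv (he ▸ hb)
    · rw [← two_mul, ← pow_succ']
      congr 1
      rw [← Finset.card_insert_of_notMem (a := (⟨i, hin⟩ : Fin n)) (by simp)]
      congr 1
      ext v
      simp only [Finset.mem_insert, Finset.mem_filter, mem_arraySet, Fin.ext_iff]
      constructor
      · rintro (h | h)
        · exact ⟨h ▸ hb, by omega⟩
        · exact ⟨h.1, by omega⟩
      · rintro ⟨h, h'⟩
        by_cases he : (v : ℕ) = i
        · exact .inl he
        · exact .inr ⟨h, by omega⟩

/-- Array `1` becomes the complement of the subset of array `6` with code `reg 8`. -/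
def decodeProg : RamProgram :=
  .seq (.add 9 8 3) (forDown 10 0 (.seq (.load 12 6 10) (.seq (.load 13 7 10) (.seq (.sub 14 13 9)
    (.branch 12 (.branch 14 (.store 1 10 2) (.seq (.sub 9 9 13) (.store 1 10 3)))
      (.store 1 10 2))))))

/-- `reg 26 ≠ 0` iff the largest connected defensive alliance that contains `reg 6` and avoids the
set with code `reg 8` was shrunk to one with at least `reg 1` elements. -/
def candidateProg : RamProgram :=
  .seq decodeProg (.seq (.add 16 6 3) (.seq peelProg (.seq (.const 26 0) (.seq (.load 12 1 6)
    (.branch 12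
      (.seq shrinkProg (.seq countProg (.seq (.sub 12 1 25) (.branch 12 (.const 12 0) (.const 26 1)))))
      (.const 12 0))))))

/-- Array `6` becomes the union of the balls of radius `reg 4` around `reg 6` and `reg 7`. -/
def ballProg : RamProgram :=
  .seq (fillLoop 1 10 0 14 (.const 14 1)) (.seq (fillLoop 2 10 0 14 (.const 14 0))
    (.seq (.store 2 6 2) (.seq (.store 2 7 2) (.seq (reachProg 4)
      (fillLoop 6 10 0 14 (.load 14 2 10))))))

/-- Array `7` and register `27` become the weights for array `6`. -/
def weightProg : RamProgram :=
  .seq (.const 27 1) (forDown 10 0 (.seq (.sub 12 0 10) (.seq (.sub 12 12 2)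
    (.seq (.store 7 12 27) (.seq (.load 13 6 12) (.branch 13 (.add 27 27 27) (.const 12 0)))))))

/-- Try all forbidden sets in the balls around `reg 6` and `reg 7`. -/
def pairProg : RamProgram :=
  .seq ballProg (.seq weightProg (anyLoop 28 8 27 26 candidateProg))

/-- The constants and the row offsets of the adjacency matrix. -/
def prepareProg : RamProgram :=
  .seq (.const 2 1) (.seq (.const 4 5) (.seq (.add 4 4 1) (.seq (.const 12 0)
    (forDown 10 0 (.seq (.sub 13 0 10) (.seq (.sub 13 13 2) (.seq (.store 5 13 12)
      (.add 12 12 0))))))))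

/-- The decision procedure for Connected Locally Minimal Defensive Alliance. -/
def allianceProg : RamProgram :=
  .seq prepareProg (.seq (anyLoop 29 6 0 30 (anyLoop 30 7 0 28 pairProg)) (.add 0 29 3))

/-! ### Correctness and running time of the decision procedure. -/

section

variable {n : ℕ} {G : SimpleGraph (Fin n)} {s : RamState}

/-- Digits are read off from the top, and register `9` holds the code of the part still to be
decoded. The claim is conditional on `F`, so no surjectivity of the coding is needed. -/
theorem runs_decodeProg (h : IsPrepared G s) (h7 : ∀ v < n, s.arr 7 v = weight (s.arr 6) v) :
    Runs decodeProg s (20 * (n + 1)) fun s' => ∀ F ⊆ arraySet n (s.arr 6),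
      s.reg 8 = setCode (s.arr 6) F n → arraySet n (s'.arr 1) = Fᶜ := by
  refine ((Runs.of_eval (T := 1) (Q := fun s' => s'.reg 9 = s.reg 8) rfl (by decide) ?_).seq
    fun s1 hs1 h9 => (Runs.forDown (N := n) (T := 9) (fun j s' => ∀ F ⊆ arraySet n (s.arr 6),
      s.reg 8 = setCode (s.arr 6) F n → s'.reg 9 = setCode (s.arr 6) F j ∧
      ∀ v : Fin n, j ≤ v → (s'.arr 1 v ≠ 0 ↔ v ∉ F)) (h.of_sameOff hs1 rfl).one
      (h.of_sameOff hs1 rfl).zero (h.of_sameOff hs1 rfl).size rfl rfl (by decide) ?_ ?_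
      fun v hv s2 hs2 hv2 hI => Runs.of_eval rfl (by decide) fun F hF h8 => ?_).mono le_rfl
        fun s2 _ h2 F hF h8 => ?_).mono
    (by omega) fun _ _ h => h
  · simp [RamProgram.eval, RamState.setReg, h.zero]
  · intro j s a h
    simpa [RamState.setReg] using h
  · intro F hF h8
    refine ⟨h9.trans h8, fun v hv => ?_⟩
    omega
  · obtain ⟨hI1, hI2⟩ := hI F hF h8
    have h2 := (h.of_sameOff hs1 rfl).of_sameOff hs2 rfl
    have e6 : s2.arr 6 = s.arr 6 := (hs2.arr 6 rfl).trans (hs1.arr 6 rfl)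
    have e7 : s2.arr 7 v = weight (s.arr 6) v := by
      rw [hs2.arr 7 rfl, hs1.arr 7 rfl, h7 v hv]
    have hlt := setCode_lt_weight hF v
    have hmap : v ∈ F.map Fin.valEmbedding ↔ (⟨v, hv⟩ : Fin n) ∈ F := by
      simp only [Finset.mem_map, Fin.valEmbedding_apply]
      exact ⟨fun ⟨u, hu, huv⟩ => (Fin.ext huv : u = ⟨v, hv⟩) ▸ hu, fun h => ⟨_, h, rfl⟩⟩
    rw [setCode] at hI1
    have hupd (x : ℕ) (hx : x ≠ 0 ↔ (⟨v, hv⟩ : Fin n) ∉ F) (u : Fin n) (hu : v ≤ u) :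
        Function.update (s2.arr 1) v x u ≠ 0 ↔ u ∉ F := by
      rcases hu.eq_or_lt with hu | hu
      · obtain rfl : u = ⟨v, hv⟩ := Fin.ext hu.symm
        simpa using hx
      · rw [Function.update_of_ne (by omega)]
        exact hI2 u hu
    by_cases hvF : (⟨v, hv⟩ : Fin n) ∈ F
    · have hb : s.arr 6 v ≠ 0 := mem_arraySet.1 (hF hvF)
      rw [if_pos (hmap.2 hvF)] at hI1
      have hw : weight (s.arr 6) v - (setCode (s.arr 6) F v + weight (s.arr 6) v) = 0 := by omega
      simp only [RamProgram.eval, RamState.setReg, RamState.setArr, hv2, e6, e7, hI1, hb, hw, h2.zero, if_true,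
        if_false, Function.update_self, ne_eq, Function.update_of_ne, not_false_eq_true, Nat.reduceEqDiff, Nat.add_sub_cancel, true_and]
      exact hupd 0 (by simpa using hvF)
    · rw [if_neg (mt hmap.1 hvF)] at hI1
      have hw : weight (s.arr 6) v - setCode (s.arr 6) F v ≠ 0 := by omega
      by_cases hb : s.arr 6 v = 0
      · simp only [RamProgram.eval, RamState.setReg, RamState.setArr, hv2, e6, e7, hI1, hb, hw, h2.one, if_true,
          if_false, Function.update_self, ne_eq, Function.update_of_ne, not_false_eq_true, Nat.reduceEqDiff, true_and]
        exact hupd 1 (by simpa using hvF)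
      · simp only [RamProgram.eval, RamState.setReg, RamState.setArr, hv2, e6, e7, hI1, hb, hw, h2.one,
          if_false, Function.update_self, ne_eq, Function.update_of_ne, not_false_eq_true, Nat.reduceEqDiff, true_and]
        exact hupd 1 (by simpa using hvF)
  · ext v
    rw [mem_arraySet, (h2 F hF h8).2 v (Nat.zero_le _), Finset.mem_compl]

/-- Every way of shrinking a connected defensive alliance that avoids `F` and contains a certain
locally minimal one with the vertex `r` ends with at least `k` vertices. -/
def ForcesLarge [DecidableRel G.Adj] (k : ℕ) (r : Fin n) (F : Finset (Fin n)) : Prop :=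
  ∃ D, IsConnectedLocallyMinimalDefensiveAlliance G D ∧ r ∈ D ∧ Disjoint D F ∧
    ∀ D₀ A, IsConnectedDefensiveAlliance G D₀ → D ⊆ D₀ → Disjoint D₀ F → ShrinksTo G D₀ A →
      k ≤ A.card

/-- Completeness: the peeled set contains the alliance `D` behind `ForcesLarge`, so it can serve as
`D₀`. Soundness does not depend on the code, since the set finally counted is a locally minimal
alliance in any case. -/
theorem runs_candidateProg (h : IsPrepared G s) [DecidableRel G.Adj]
    (h7 : ∀ v < n, s.arr 7 v = weight (s.arr 6) v) {r : ℕ} (hr : r < n) (hs : s.reg 6 = r) :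
    Runs candidateProg s (400 * (n + 1) ^ 5) fun s' =>
      ((∃ F ⊆ arraySet n (s.arr 6), s.reg 8 = setCode (s.arr 6) F n ∧
        ForcesLarge (G := G) (s.reg 1) ⟨r, hr⟩ F) → s'.reg 26 ≠ 0) ∧
      (s'.reg 26 ≠ 0 → ∃ D, IsConnectedLocallyMinimalDefensiveAlliance G D ∧ s.reg 1 ≤ D.card) := by
  refine ((runs_decodeProg h h7).seq fun s1 hs1 hdec =>
    (Runs.of_eval (T := 1) (Q := fun s' => s'.reg 16 = r) rfl (by decide) ?_).seq fun s2 hs2 h16 =>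
    (runs_peelProg ((h.of_sameOff hs1 rfl).of_sameOff hs2 rfl) hr h16).seq
    fun s3 hs3 ⟨hp1, hp2, hp3⟩ =>
    (Runs.of_eval (T := 1) (Q := fun s' => s'.reg 26 = 0) rfl (by decide) ?_).seq fun s4 hs4 h26 =>
    (Runs.of_eval (T := 1) (Q := fun s' => s'.reg 12 = s3.arr 1 r) rfl (by decide) ?_).seq
    fun s5 hs5 h12 => Runs.branch (T := 162 * (n + 1) ^ 5 + (10 * (n + 1) + (1 + 3)))
      (fun h0 => ?_) fun h0 => ?_).mono ?_ fun _ _ h => h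
  · have e6 : s1.reg 6 = r := (hs1.reg 6 rfl).trans hs
    simp [RamProgram.eval, RamState.setReg, e6, (h.of_sameOff hs1 rfl).zero]
  · simp [RamProgram.eval, RamState.setReg]
  · have e6 : s4.reg 6 = r := by
      rw [hs4.reg 6 rfl, hs3.reg 6 rfl, hs2.reg 6 rfl, hs1.reg 6 rfl, hs]
    simp [RamProgram.eval, RamState.setReg, e6, hs4.arr 1 rfl]
  · have h5 := ((((h.of_sameOff hs1 rfl).of_sameOff hs2 rfl).of_sameOff hs3 rfl).of_sameOff
      hs4 rfl).of_sameOff hs5 rfl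
    have e1 : s5.arr 1 = s3.arr 1 := (hs5.arr 1 rfl).trans (hs4.arr 1 rfl)
    have er1 : s5.reg 1 = s.reg 1 := by
      rw [hs5.reg 1 rfl, hs4.reg 1 rfl, hs3.reg 1 rfl, hs2.reg 1 rfl, hs1.reg 1 rfl]
    have hcda := hp3 (mem_arraySet.2 (h12 ▸ h0))
    refine (runs_shrinkProg h5).seq fun s6 hs6 ⟨hS, hmin⟩ =>
      (runs_countProg (h5.of_sameOff hs6 rfl)).seq fun s7 hs7 h25 =>
      (Runs.of_eval (T := 1) (Q := fun s' => s'.reg 12 = 0 ↔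
        s.reg 1 ≤ (arraySet n (s6.arr 1)).card) rfl (by decide) ?_).seq fun s8 hs8 h12' =>
      Runs.of_eval rfl (by decide) ?_
    · have : s7.reg 1 = s.reg 1 := by rw [hs7.reg 1 rfl, hs6.reg 1 rfl, er1]
      simp only [RamProgram.eval, RamState.setReg, Function.update_self, this, h25]
      omega
    · rw [e1] at hS
      have h26' : s8.reg 26 = 0 := by
        rw [hs8.reg 26 rfl, hs7.reg 26 rfl, hs6.reg 26 rfl, hs5.reg 26 rfl, h26]
      by_cases hk : s.reg 1 ≤ (arraySet n (s6.arr 1)).card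
      · simp only [RamProgram.eval, h12'.2 hk, if_true, RamState.setReg, Function.update_self]
        exact ⟨fun _ => by simp, fun _ => ⟨_, ⟨hS.isConnectedDefensiveAlliance hcda, hmin⟩, hk⟩⟩
      · simp only [RamProgram.eval, (not_congr h12').2 hk, if_false, RamState.setReg,
          Function.update_of_ne (show (26 : ℕ) ≠ 12 by decide), h26']
        refine ⟨?_, by simp⟩
        rintro ⟨F, hF, h8, D, hD, hrD, hDF, hforce⟩
        have hF1 := hdec F hF h8
        rw [hs2.arr 1 rfl, hF1] at hp1 hp2
        have hDF' : D ⊆ Fᶜ := (Finset.subset_compl_iff_disjoint_right).2 hDF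
        exact (hk (hforce _ _ hcda (hp2 D hD.1 hrD hDF')
          ((Finset.subset_compl_iff_disjoint_right).1 hp1) hS)).elim
  · refine Runs.of_eval (T := 1) rfl (by decide) ?_ |>.mono (by omega) fun _ _ h => h
    simp only [RamProgram.eval, RamState.setReg,
      Function.update_of_ne (show (26 : ℕ) ≠ 12 by decide), hs5.reg 26 rfl, h26]
    refine ⟨?_, by simp⟩
    rintro ⟨F, hF, h8, D, hD, hrD, hDF, hforce⟩
    have hF1 := hdec F hF h8
    rw [hs2.arr 1 rfl, hF1] at hp2
    have hDF' : D ⊆ Fᶜ := (Finset.subset_compl_iff_disjoint_right).2 hDF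
    exact (mem_arraySet.1 (hp2 D hD.1 hrD hDF' hrD) (h12 ▸ h0)).elim
  · have := Nat.pow_le_pow_right (n := n + 1) (by omega) (show 4 ≤ 5 by omega)
    have := Nat.le_self_pow (n := 5) (by omega) (n + 1)
    omega

theorem runs_ballProg (h : IsPrepared G s) {m r r' : ℕ} (hr : r < n) (hr' : r' < n)
    (h6 : s.reg 6 = r) (h7 : s.reg 7 = r') (h4 : s.reg 4 = m) :
    Runs ballProg s ((m + 1) * (80 * (n + 1) ^ 2)) fun s' =>
      arraySet n (s'.arr 6) = reachSet G Finset.univ {⟨r, hr⟩, ⟨r', hr'⟩} m := by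
  refine ((Runs.fillLoop (N := n) (T := 1) (P := fun _ => True) h.one h.zero h.size rfl (by decide)
    fun v hv s1 hs1 hv1 => Runs.of_eval rfl (by decide) ?_).seq fun s1 hs1 hone =>
    (Runs.fillLoop (N := n) (T := 1) (P := fun _ => False) (h.of_sameOff hs1 rfl).one
    (h.of_sameOff hs1 rfl).zero (h.of_sameOff hs1 rfl).size rfl (by decide)
    fun v hv s1 hs1 hv1 => Runs.of_eval rfl (by decide) ?_).seq fun s2 hs2 hzero =>
    (Runs.of_eval (T := 1) (Q := fun s' => arraySet n (s'.arr 2) = {(⟨r, hr⟩ : Fin n)}) rfl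
      (by decide) ?_).seq fun s3 hs3 h3 =>
    (Runs.of_eval (T := 1) (Q := fun s' => arraySet n (s'.arr 2) =
      {(⟨r, hr⟩ : Fin n), ⟨r', hr'⟩}) rfl (by decide) ?_).seq fun s4 hs4 h4' =>
    (?_ : Runs _ _ ((m + 1) * (52 * (n + 1) ^ 2) + (n + 1) * 4) _)).mono ?_ fun _ _ h => h
  · simp [RamProgram.eval, RamState.setReg]
  · simp [RamProgram.eval, RamState.setReg]
  · have e6 : s2.reg 6 = r := by rw [hs2.reg 6 rfl, hs1.reg 6 rfl, h6]
    simp only [RamProgram.eval, RamState.setArr, Function.update_self, e6,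
      ((h.of_sameOff hs1 rfl).of_sameOff hs2 rfl).one, arraySet_update_one hr]
    have : arraySet n (s2.arr 2) = ∅ := by
      ext v
      simp [mem_arraySet, not_not.1 (hzero v v.2).1]
    rw [this]
    rfl
  · have e7 : s3.reg 7 = r' := by rw [hs3.reg 7 rfl, hs2.reg 7 rfl, hs1.reg 7 rfl, h7]
    simp only [RamProgram.eval, RamState.setArr, Function.update_self, e7,
      (((h.of_sameOff hs1 rfl).of_sameOff hs2 rfl).of_sameOff hs3 rfl).one,
      arraySet_update_one hr', h3]
    exact Finset.pair_comm _ _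
  · have hp := (((h.of_sameOff hs1 rfl).of_sameOff hs2 rfl).of_sameOff hs3 rfl).of_sameOff hs4 rfl
    have e4 : s4.reg 4 = m := by
      rw [hs4.reg 4 rfl, hs3.reg 4 rfl, hs2.reg 4 rfl, hs1.reg 4 rfl, h4]
    have e1 : arraySet n (s4.arr 1) = Finset.univ := by
      rw [hs4.arr 1 rfl, hs3.arr 1 rfl, hs2.arr 1 rfl]
      ext v
      simp [mem_arraySet, (hone v v.2).2 trivial]
    refine (runs_reachProg hp e4).seq fun s5 hs5 h5 => ?_
    have hp5 := hp.of_sameOff (p := reachProg 4) hs5 rfl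
    refine (Runs.fillLoop (N := n) (T := 1) (P := fun v => s5.arr 2 v ≠ 0) hp5.one hp5.zero hp5.size
      rfl (by decide) fun v hv s6 hs6 hv6 => Runs.of_eval rfl (by decide) ?_).mono le_rfl ?_
    · simp [RamProgram.eval, RamState.setReg, hv6, hs6.arr 2 rfl]
    · intro s6 _ hs6
      rw [← e1, ← h4', ← h5]
      ext v
      rw [mem_arraySet, hs6 v v.2, mem_arraySet]
  · have : (m + 1) * (80 * (n + 1) ^ 2) = (m + 1) * (52 * (n + 1) ^ 2) +
        28 * ((m + 1) * (n + 1) ^ 2) := by ring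
    have := Nat.le_self_pow (n := 2) (by omega) (n + 1)
    have := Nat.le_mul_of_pos_left ((n + 1) ^ 2) (show 0 < m + 1 by omega)
    omega

theorem runs_weightProg (h : IsPrepared G s) :
    Runs weightProg s (20 * (n + 1)) fun s' =>
      (∀ v < n, s'.arr 7 v = weight (s.arr 6) v) ∧ s'.reg 27 = weight (s.arr 6) n := by
  refine ((Runs.of_eval (T := 1) (Q := fun s' => s'.reg 27 = 1) rfl (by decide) ?_).seq
    fun s1 hs1 h27 => (Runs.forDown (N := n) (T := 8) (fun j s' =>
      (∀ v < n - j, s'.arr 7 v = weight (s.arr 6) v) ∧ s'.reg 27 = weight (s.arr 6) (n - j))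
      (h.of_sameOff hs1 rfl).one
      (h.of_sameOff hs1 rfl).zero (h.of_sameOff hs1 rfl).size rfl rfl (by decide) ?_ ?_
      fun v hv s2 hs2 hv2 hI => Runs.of_eval rfl (by decide) ?_).mono le_rfl fun s2 _ h2 => ?_).mono
    (by omega) fun _ _ h => h
  · simp [RamProgram.eval, RamState.setReg]
  · intro j s a h
    simpa [RamState.setReg] using h
  · simp [weight, h27]
  · have h2 := (h.of_sameOff hs1 rfl).of_sameOff hs2 rfl
    have e6 : s2.arr 6 = s.arr 6 := (hs2.arr 6 rfl).trans (hs1.arr 6 rfl)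
    -- Weights accumulate from vertex 0 upwards while the loop counts down, so the vertex treated is
    -- `n - v - 1`.
    obtain ⟨u, hu⟩ : ∃ u, n - (v + 1) = u := ⟨_, rfl⟩
    have hu1 : n - v = u + 1 := by omega
    have hu2 : n - v - 1 = u := by omega
    rw [hu] at hI
    have key : ∀ w < u + 1, Function.update (s2.arr 7) u (weight (s.arr 6) u) w =
        weight (s.arr 6) w := by
      intro w hw
      by_cases hwu : w = u
      · simp [hwu]
      · rw [Function.update_of_ne hwu]
        exact hI.1 w (by omega)
    rw [hu1, weight]
    by_cases hb : s.arr 6 u = 0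
    · simp [RamProgram.eval, RamState.setReg, RamState.setArr, h2.size, h2.one, hv2, hu2, e6, hI.2,
        hb, -Order.lt_add_one_iff]
      exact key
    · simp [RamProgram.eval, RamState.setReg, RamState.setArr, h2.size, h2.one, hv2, hu2, e6, hI.2,
        hb, -Order.lt_add_one_iff]
      exact key
  · simpa using h2

theorem runs_pairProg (h : IsPrepared G s) [DecidableRel G.Adj] {k r r' : ℕ} (hr : r < n)
    (hr' : r' < n) (h6 : s.reg 6 = r) (h7 : s.reg 7 = r') (h1 : s.reg 1 = k)
    (h4 : s.reg 4 = k + 5) :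
    Runs pairProg s (1000 * ((k + 6) * 2 ^ (2 * (G.maxDegree + 1) ^ (k + 5))) * (n + 1) ^ 5)
      fun s' =>
      ((∃ F ⊆ ballSet G ⟨r, hr⟩ (k + 5) ∪ ballSet G ⟨r', hr'⟩ (k + 5),
        ForcesLarge (G := G) k ⟨r, hr⟩ F) → s'.reg 28 ≠ 0) ∧
      (s'.reg 28 ≠ 0 → ∃ D, IsConnectedLocallyMinimalDefensiveAlliance G D ∧ k ≤ D.card) := by
  set M := 2 ^ (2 * (G.maxDegree + 1) ^ (k + 5)) with hM
  refine ((runs_ballProg h hr hr' h6 h7 h4).seq fun s1 hs1 hball =>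
    (runs_weightProg (h.of_sameOff hs1 rfl)).seq fun s2 hs2 ⟨hw, h27⟩ =>
    (?_ : Runs _ _ ((M + 1) * (400 * (n + 1) ^ 5 + 6)) _)).mono ?_ fun _ _ h => h
  · have h2 := (h.of_sameOff hs1 rfl).of_sameOff hs2 rfl
    have e6 : s2.arr 6 = s1.arr 6 := hs2.arr 6 rfl
    rw [← e6] at hw h27 hball
    -- The weight is the number of subsets of the two balls, and each ball has at most `(Δ + 1) ^ (k
    -- + 5)` vertices.
    have hwM : weight (s2.arr 6) n ≤ M := by
      rw [weight_eq (n := n) _ le_rfl, hM]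
      refine Nat.pow_le_pow_right (by omega) ((Finset.card_filter_le _ _).trans ?_)
      rw [hball]
      refine (card_reachSet_le _ _ _).trans ?_
      rw [mul_comm]
      exact Nat.mul_le_mul_right _ Finset.card_le_two
    refine (Runs.anyLoop (N := weight (s2.arr 6) n) (T := 400 * (n + 1) ^ 5)
      (P := fun j => ∃ F ⊆ arraySet n (s2.arr 6), j = setCode (s2.arr 6) F n ∧
        ForcesLarge (G := G) k ⟨r, hr⟩ F)
      (Q := fun _ => ∃ D, IsConnectedLocallyMinimalDefensiveAlliance G D ∧ k ≤ D.card)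
      h2.one h2.zero h27 rfl rfl fun j hj s3 hs3 hj3 => ?_).mono (by gcongr) fun s3 _ ⟨hP, hQ⟩ =>
        ⟨?_, fun h => (hQ h).2.elim fun _ h => h.2⟩
    · have h3 := h2.of_sameOff hs3 rfl
      have e63 : s3.arr 6 = s2.arr 6 := hs3.arr 6 rfl
      have e73 : s3.arr 7 = s2.arr 7 := hs3.arr 7 rfl
      have e1 : s3.reg 1 = k := by rw [hs3.reg 1 rfl, hs2.reg 1 rfl, hs1.reg 1 rfl, h1]
      have er : s3.reg 6 = r := by rw [hs3.reg 6 rfl, hs2.reg 6 rfl, hs1.reg 6 rfl, h6]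
      have := runs_candidateProg h3 (by rwa [e63, e73]) hr er
      rwa [e63, hj3, e1] at this
    · rintro ⟨F, hF, hlarge⟩
      have hFb : F ⊆ arraySet n (s2.arr 6) := by
        rw [hball]
        refine hF.trans (Finset.union_subset ?_ ?_)
        · exact reachSet_mono G subset_rfl (by simp) le_rfl
        · exact reachSet_mono G subset_rfl (by simp) le_rfl
      exact hP ⟨_, setCode_lt_weight hFb n, F, hFb, rfl, hlarge⟩
  · have hM1 : 1 ≤ M := Nat.one_le_two_pow
    have a1 := Nat.pow_le_pow_right (n := n + 1) (by omega) (show 2 ≤ 5 by omega)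
    have a2 := Nat.le_self_pow (n := 5) (by omega) (n + 1)
    have a3 := Nat.one_le_pow 5 (n + 1) (by omega)
    set N := (n + 1) ^ 5
    calc _ ≤ (k + 6) * (80 * N) + (20 * N + (M + M) * (400 * N + 6 * N)) := by (gcongr; all_goals omega)
      _ = 80 * ((k + 6) * 1 * N) + 20 * (1 * 1 * N) + 812 * (1 * M * N) := by ring
      _ ≤ 80 * ((k + 6) * M * N) + 20 * ((k + 6) * M * N) + 812 * ((k + 6) * M * N) := by
        gcongr <;> omega
      _ ≤ 1000 * ((k + 6) * M) * N := by
        rw [mul_assoc 1000]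
        omega

/-- Quotient and remainder by `n` recover row and column from a matrix position. -/
theorem ramInput_arr_ne_zero (G : SimpleGraph (Fin n)) (k : ℕ) (u v : Fin n) :
    (ramInput G k).arr 0 (u * n + v) ≠ 0 ↔ G.Adj u v := by
  classical
  simp only [ramInput, true_and, ne_eq, ite_eq_right_iff, one_ne_zero, imp_false, not_not]
  refine ⟨?_, fun h => ⟨u, v, h, rfl⟩⟩
  rintro ⟨i, j, h, he⟩
  have hn : 0 < n := u.pos
  have hv := congrArg (· % n) he
  have hu := congrArg (· / n) he
  simp only [Nat.mul_comm _ n, Nat.mul_add_mod, Nat.mod_eq_of_lt v.2, Nat.mod_eq_of_lt j.2,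
    Nat.mul_add_div hn, Nat.div_eq_of_lt v.2, Nat.div_eq_of_lt j.2, Nat.add_zero] at hu hv
  rwa [Fin.ext hu, Fin.ext hv]

/-- Row offsets are tabulated by repeated addition, as the machine cannot multiply. -/
theorem runs_prepareProg (G : SimpleGraph (Fin n)) (k : ℕ) :
    Runs prepareProg (ramInput G k) (20 * (n + 1)) fun s' =>
      IsPrepared G s' ∧ s'.reg 1 = k ∧ s'.reg 4 = k + 5 := by
  refine ((Runs.of_eval (T := 1) (Q := fun s' => s'.reg 2 = 1) rfl (by decide) ?_).seq fun s1 hs1 e2 =>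
    (Runs.of_eval (T := 1) (Q := fun s' => s'.reg 4 = 5) rfl (by decide) ?_).seq fun s2 hs2 h4 =>
    (Runs.of_eval (T := 1) (Q := fun s' => s'.reg 4 = k + 5) rfl (by decide) ?_).seq fun s3 hs3 h5 =>
    (Runs.of_eval (T := 1) (Q := fun s' => s'.reg 12 = 0) rfl (by decide) ?_).seq fun s4 hs4 h12 =>
    (?_ : Runs _ _ ((n + 1) * 6) _)).mono (by omega) fun _ _ h => h
  · simp [RamProgram.eval, RamState.setReg]
  · simp [RamProgram.eval, RamState.setReg]
  · have : s2.reg 1 = k := by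
      rw [hs2.reg 1 rfl, hs1.reg 1 rfl]
      simp [ramInput]
    simp only [RamProgram.eval, RamState.setReg, Function.update_self, h4, this]
    omega
  · simp [RamProgram.eval, RamState.setReg]
  · have e0 : s4.reg 0 = n := by
      rw [hs4.reg 0 rfl, hs3.reg 0 rfl, hs2.reg 0 rfl, hs1.reg 0 rfl]
      simp [ramInput]
    have e1 : s4.reg 1 = k := by
      rw [hs4.reg 1 rfl, hs3.reg 1 rfl, hs2.reg 1 rfl, hs1.reg 1 rfl]
      simp [ramInput]
    have e2 : s4.reg 2 = 1 := by rw [hs4.reg 2 rfl, hs3.reg 2 rfl, hs2.reg 2 rfl, e2]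
    have e3 : s4.reg 3 = 0 := by
      rw [hs4.reg 3 rfl, hs3.reg 3 rfl, hs2.reg 3 rfl, hs1.reg 3 rfl]
      simp [ramInput]
    have e4 : s4.reg 4 = k + 5 := by rw [hs4.reg 4 rfl, h5]
    have ea : s4.arr 0 = (ramInput G k).arr 0 := by
      rw [hs4.arr 0 rfl, hs3.arr 0 rfl, hs2.arr 0 rfl, hs1.arr 0 rfl]
    refine (Runs.forDown (N := n) (T := 4) (fun j s' =>
      (∀ v < n - j, s'.arr 5 v = v * n) ∧ s'.reg 12 = (n - j) * n)
      e2 e3 e0 rfl rfl (by decide) ?_ ?_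
      fun v hv s5 hs5 hv5 hI => Runs.of_eval rfl (by decide) ?_).mono le_rfl fun s5 hs5 hI => ?_
    · intro j s a h
      simpa [RamState.setReg] using h
    · simp [h12]
    · have f0 : s5.reg 0 = n := (hs5.reg 0 rfl).trans e0
      have f2 : s5.reg 2 = 1 := (hs5.reg 2 rfl).trans e2
      obtain ⟨u, hu⟩ : ∃ u, n - (v + 1) = u := ⟨_, rfl⟩
      have hu1 : n - v = u + 1 := by omega
      have hu2 : n - v - 1 = u := by omega
      rw [hu] at hI
      have key : ∀ w < u + 1, Function.update (s5.arr 5) u (u * n) w = w * n := by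
        intro w hw
        by_cases hwu : w = u
        · simp [hwu]
        · rw [Function.update_of_ne hwu]
          exact hI.1 w (by omega)
      rw [hu1]
      simp [RamProgram.eval, RamState.setReg, RamState.setArr, f0, f2, hv5, hu2, hI.2,
        -Order.lt_add_one_iff, Nat.succ_mul]
      exact key
    · refine ⟨⟨(hs5.reg 0 rfl).trans e0, (hs5.reg 2 rfl).trans e2, (hs5.reg 3 rfl).trans e3, ?_,
        fun u hu => hI.1 u (by omega)⟩, (hs5.reg 1 rfl).trans e1, (hs5.reg 4 rfl).trans e4⟩
      intro u v
      rw [hs5.arr 0 rfl, ea]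
      exact ramInput_arr_ne_zero G k u v

/-- The two loops over centres raise the exponent of `n + 1` from 5 to 7. -/
theorem runs_allianceProg (G : SimpleGraph (Fin n)) [DecidableRel G.Adj] (k : ℕ) :
    Runs allianceProg (ramInput G k)
      (2000 * ((k + 6) * 2 ^ (2 * (G.maxDegree + 1) ^ (k + 5))) * (n + 1) ^ 7)
      fun s' => (s'.reg 0 = 0 ∨ s'.reg 0 = 1) ∧ (s'.reg 0 ≠ 0 ↔
        ∃ D, IsConnectedLocallyMinimalDefensiveAlliance G D ∧ k ≤ D.card) := by
  set C := (k + 6) * 2 ^ (2 * (G.maxDegree + 1) ^ (k + 5)) with hC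
  refine ((runs_prepareProg G k).seq fun s1 hs1 ⟨h1, hk, h4⟩ =>
    (Runs.anyLoop (N := n) (T := (n + 1) * (1000 * C * (n + 1) ^ 5 + 6))
      (P := fun r => ∃ hr : r < n, ∃ r', ∃ hr' : r' < n,
        ∃ F ⊆ ballSet G ⟨r, hr⟩ (k + 5) ∪ ballSet G ⟨r', hr'⟩ (k + 5),
          ForcesLarge (G := G) k ⟨r, hr⟩ F)
      (Q := fun _ => ∃ D, IsConnectedLocallyMinimalDefensiveAlliance G D ∧ k ≤ D.card)
      h1.one h1.zero h1.size rfl rfl fun r hr s2 hs2 hr2 => ?_).seq fun s2 hs2 ⟨hP, hQ⟩ =>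
    Runs.of_eval (T := 1) rfl (by decide) ?_).mono ?_ fun _ _ h => h
  · have h2 := h1.of_sameOff hs2 rfl
    refine (Runs.anyLoop (N := n) (T := 1000 * C * (n + 1) ^ 5)
      (P := fun r' => ∃ hr' : r' < n,
        ∃ F ⊆ ballSet G ⟨r, hr⟩ (k + 5) ∪ ballSet G ⟨r', hr'⟩ (k + 5),
          ForcesLarge (G := G) k ⟨r, hr⟩ F)
      (Q := fun _ => ∃ D, IsConnectedLocallyMinimalDefensiveAlliance G D ∧ k ≤ D.card)
      h2.one h2.zero h2.size rfl rfl fun r' hr' s3 hs3 hr3 => ?_).mono le_rfl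
        fun s3 _ ⟨hP, hQ⟩ => ⟨?_, fun h => (hQ h).2.elim fun _ h => h.2⟩
    · refine (runs_pairProg (h2.of_sameOff hs3 rfl) hr hr' ((hs3.reg 6 rfl).trans hr2) hr3
        ?_ ?_).mono le_rfl fun s4 _ ⟨hP, hQ⟩ => ⟨fun ⟨_, h⟩ => hP h, hQ⟩
      · rw [hs3.reg 1 rfl, hs2.reg 1 rfl, hk]
      · rw [hs3.reg 4 rfl, hs2.reg 4 rfl, h4]
    · rintro ⟨_, r', hr', h⟩
      exact hP ⟨r', hr', hr', h⟩
  · have hC1 : 1 ≤ C := Nat.mul_pos (by omega) (by positivity)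
    have a1 := Nat.le_self_pow (n := 7) (by omega) (n + 1)
    have a2 := Nat.pow_le_pow_right (n := n + 1) (by omega) (show 2 ≤ 7 by omega)
    have a3 := Nat.one_le_pow 7 (n + 1) (by omega)
    have a4 := Nat.le_mul_of_pos_left ((n + 1) ^ 7) hC1
    calc _ = 1000 * (C * (n + 1) ^ 7) + 6 * (n + 1) ^ 2 + 26 * (n + 1) + 1 := by ring
      _ ≤ 2000 * (C * (n + 1) ^ 7) := by omega
      _ = _ := by ring
  · have e3 : s2.reg 3 = 0 := (h1.of_sameOff hs2 rfl).zero
    simp only [RamProgram.eval, RamState.setReg, Function.update_self, e3, Nat.add_zero]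
    refine ⟨?_, fun h => (hQ h).2.elim fun _ h => h.2, ?_⟩
    · by_cases h0 : s2.reg 29 = 0
      · exact .inl h0
      · exact .inr (hQ h0).1
    · rintro ⟨D, hD, hkD⟩
      obtain ⟨x, hx, y, F, hF, hDF, hforce⟩ := exists_forbidden_set hD hkD
      exact hP ⟨x, x.2, x.2, y, y.2, F, hF, D, hD, hx, hDF, hforce⟩

end

/-! ### Computability of the time bound, and the theorem. -/

theorem primrec_pow : Primrec₂ ((· ^ ·) : ℕ → ℕ → ℕ) :=
  Primrec₂.unpaired'.1 Nat.Primrec.pow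

theorem computable_timeBound : Computable fun x : ℕ × ℕ =>
    2000 * ((x.1 + 6) * 2 ^ (2 * (x.2 + 1) ^ (x.1 + 5))) := by
  have add (a : ℕ) {f : ℕ × ℕ → ℕ} (hf : Primrec f) : Primrec fun x => f x + a :=
    Primrec.nat_add.comp hf (.const a)
  have mul (a : ℕ) {f : ℕ × ℕ → ℕ} (hf : Primrec f) : Primrec fun x => a * f x :=
    Primrec.nat_mul.comp (.const a) hf
  exact (mul 2000 (Primrec.nat_mul.comp (add 6 .fst) (primrec_pow.comp (.const 2)
    (mul 2 (primrec_pow.comp (add 1 .snd) (add 5 .fst)))))).to_comp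

theorem theorem4p4 :
    IsFPT ConnectedLocallyMinimalDefensiveAlliance solutionSizeAndMaxDegree := by
  classical
  refine ⟨allianceProg, _, 7, computable_timeBound, fun n G k => ?_⟩
  obtain ⟨t, s, he, ht, h01, hs⟩ := runs_allianceProg G k
  refine ⟨t, s, he, ht.trans ?_, ?_⟩
  · have : n + 1 ≤ instanceSize n k := by
      have := Nat.le_self_pow (n := 2) (by omega) n
      rw [instanceSize]
      omega
    exact Nat.mul_le_mul le_rfl (Nat.pow_le_pow_left this 7)
  · have hQ : ConnectedLocallyMinimalDefensiveAlliance n G k ↔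
        ∃ D, IsConnectedLocallyMinimalDefensiveAlliance G D ∧ k ≤ D.card := Iff.rfl
    rw [hQ, ← hs]
    rcases h01 with h | h <;> simp [h]
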